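/- **Setting.** Let $\mathbb O$ be the real algebra of octonions with basis $e_0=1,e_1,\dots,e_7$, where $e_ie_j=\varepsilon_{ijk}e_k-\delta_{ij}$ for $i,j\ge 1$ and $\varepsilon$ is the alternating symbol of $e^{123}+e^{145}+e^{167}+e^{246}-e^{257}-e^{347}-e^{356}$. An $\mathbb O$-bimodule is a real vector space $M$ with real bilinear unital left and right multiplications by $\mathbb O$ such that $[p,q,m]:=(pq)m-p(qm)$ is alternating in $p,q$ and $[p,q,m]=[m,p,q]=[q,m,p]$, where $[m,p,q]=(mp)q-m(pq)$ and $[q,m,p]=(qm)p-q(mp)$. Put $\operatorname{Re}M=\{m\in M: [p,q,m]=0\ \forall p,q\in\mathbb O\}$. Then $M=\bigoplus_{i=0}^7 e_i\operatorname{Re}M$, and $\operatorname{Re}:M\to\operatorname{Re}M$ denotes the projection onto the summand with $i=0$, that is $\operatorname{Re}x=\frac5{12}x-\frac1{12}\sum_{i=1}^7 e_ixe_i$. For a real linear map $f:M\to M'$ of $\mathbb O$-bimodules put $A_p(x,f)=f(px)-pf(x)$ and $B_p(f,x)=f(x)p-f(xp)$. The map $f$ is *left* (resp. *right*) *para-linear*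 if $\operatorname{Re}A_p(x,f)=0$ (resp. $\operatorname{Re}B_p(f,x)=0$) for all $p\in\mathbb O$, $x\in M$. The set $\operatorname{Hom}_{\mathcal{LO}}(M,M')$ of left para-linear maps is an $\mathbb O$-bimodule by $(r\odot f)(x)=f(xr)+A_r(x,f)$ and $(f\odot r)(x)=f(x)r-A_r(x,f)$. The left and right regular compositions are $$(f\circledcirc g)(x)=f(g(x))-\sum_{j=1}^7e_j\operatorname{Re}f(A_{e_j}(x,g)),\qquad (f\circledcirc_r g)(x)=f(g(x))+\sum_{j=1}^7\bigl(\operatorname{Re}f(B_{e_j}(g,x))\bigr)e_j .$$ Let $\mathcal{LO}$ (resp. $\mathcal{RO}$) be the non-associative category of $\mathbb O$-bimodules with left (resp. right) para-linear maps and left (resp. right) regular compositions. Let $\mathbb O\text{-}\mathbf{Mod}_{\mathbb R}$ be the category of $\mathbb O$-bimodules with real linear maps and the usual compositions. Let $\iota:\mathcal{LO}\to\mathbb O\text{-}\mathbf{Mod}_{\mathbb R}$ and $\iota:\mathcal{RO}\to\mathbb O\text{-}\mathbf{Mod}_{\mathbb R}$ be the weak functors that are the identity on objects and on maps. (A weak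 functor preserves identities, and preserves $gf$ whenever $f$ or $g$ is an associative morphism, i.e. one such that every composite of three morphisms that contains it is associative.) **Functors.** Fix an $\mathbb O$-bimodule $M$. There are the functors * $\operatorname{Hom}_{\mathcal{LO}}(-,M):\mathcal{LO}\to\mathcal{RO}$, contravariant, $f\mapsto(g\mapsto g\circledcirc f)$, and $\operatorname{Hom}_{\mathcal{LO}}(M,-):\mathcal{LO}\to\mathcal{LO}$, covariant, $f\mapsto(g\mapsto f\circledcirc g)$; * $\operatorname{Hom}_{\mathbb R}(-,\operatorname{Re}M)$ and $\operatorname{Hom}_{\mathbb R}(\operatorname{Re}M,-)$ from $\mathbb O\text{-}\mathbf{Mod}_{\mathbb R}$ to itself, contravariant and covariant, acting on maps by composition, where $\operatorname{Hom}_{\mathbb R}(X,\operatorname{Re}M)$ is a bimodule by $(pf)(x)=f(xp)$, $(fp)(x)=f(px)$, and $\operatorname{Hom}_{\mathbb R}(\operatorname{Re}M,X)$ by $(pf)(x)=p\,f(x)$, $(fp)(x)=f(x)p$. **Transformations.** Let $S:\mathbb O\text{-}\mathbf{Mod}_{\mathbb R}\to\mathbb O\text{-}\mathbf{Mod}_{\mathbb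 R}$ and $T:\mathcal{LO}\to\mathcal D$, with $\mathcal D\in\{\mathcal{LO},\mathcal{RO}\}$, be covariant functors. A *natural lift transformation* $S\to T$ is a family of morphisms $\tau_X:S(\iota X)\to\iota(TX)$ of $\mathbb O\text{-}\mathbf{Mod}_{\mathbb R}$ with $\iota(Tf)\circ\tau_X=\tau_Y\circ S(\iota f)$ for all $f:X\to Y$ in $\mathcal{LO}$. A *natural extension transformation* $T\to S$ is a family $\eta_X:\iota(TX)\to S(\iota X)$ with $S(\iota f)\circ\eta_X=\eta_Y\circ\iota(Tf)$ for all $f:X\to Y$ in $\mathcal{LO}$. Each is called an *isomorphism* if all its members are isomorphisms of $\mathbb O\text{-}\mathbf{Mod}_{\mathbb R}$, and then $S$ is called a *natural associated functor* of $T$. For contravariant functors the definitions are the same with the arrows $Sf$ and $Tf$ reversed. **Theorem.** For every $\mathbb O$-bimodule $M$: 1. The para-linear lifts $$l\text{-}\mathrm{lif}_X:\operatorname{Hom}_{\mathbb R}(X,\operatorname{Re}M)\to\operatorname{Hom}_{\mathcal{LO}}(X,M),\qquad (l\text{-}\mathrm{lif}\,g)(x)=g(x)-\sum_{i=1}^7e_i\,g(e_ix),$$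 form a natural lift isomorphism of contravariant functors $\operatorname{Hom}_{\mathbb R}(-,\operatorname{Re}M)\cong\operatorname{Hom}_{\mathcal{LO}}(-,M)$. 2. The para-linear extensions $$l\text{-}\mathrm{ext}_X:\operatorname{Hom}_{\mathbb R}(\operatorname{Re}M,X)\to\operatorname{Hom}_{\mathcal{LO}}(M,X),\qquad (l\text{-}\mathrm{ext}\,g)(px)=p\,g(x)\quad(p\in\mathbb O,\ x\in\operatorname{Re}M),$$ are isomorphisms of $\mathbb O\text{-}\mathbf{Mod}_{\mathbb R}$ with $\iota(\operatorname{Hom}_{\mathcal{LO}}(M,f))\circ l\text{-}\mathrm{ext}_X=l\text{-}\mathrm{ext}_Y\circ\operatorname{Hom}_{\mathbb R}(\operatorname{Re}M,\iota f)$ for all $f:X\to Y$ in $\mathcal{LO}$. Their inverses are the restrictions $f\mapsto f|_{\operatorname{Re}M}$, and these form a natural extension isomorphism $\operatorname{Hom}_{\mathcal{LO}}(M,-)\to\operatorname{Hom}_{\mathbb R}(\operatorname{Re}M,-)$. Consequently $\operatorname{Hom}_{\mathbb R}(-,\operatorname{Re}M)$ and $\operatorname{Hom}_{\mathbb R}(\operatorname{Re}M,-)$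 are natural associated functors of $\operatorname{Hom}_{\mathcal{LO}}(-,M)$ and $\operatorname{Hom}_{\mathcal{LO}}(M,-)$, respectively. -/

import Mathlib

namespace ParaLinear

/-- The octonions, as the real vector space with basis `e₀ = 1, e₁, …, e₇`. -/
def Octonion : Type := Fin 8 → ℝ

namespace Octonion

noncomputable instance : AddCommGroup Octonion := inferInstanceAs (AddCommGroup (Fin 8 → ℝ))
noncomputable instance : Module ℝ Octonion := inferInstanceAs (Module ℝ (Fin 8 → ℝ))

/-- The octonion with given coordinates. -/
def mk (f : Fin 8 → ℝ) : Octonion := f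

/-- The `i`-th coordinate. -/
noncomputable def coord (i : Fin 8) : Octonion →ₗ[ℝ] ℝ :=
  (LinearMap.proj i : (Fin 8 → ℝ) →ₗ[ℝ] ℝ)

@[simp] theorem coord_mk (f : Fin 8 → ℝ) (i : Fin 8) : coord i (mk f) = f i := rfl

theorem ext {x y : Octonion} (h : ∀ i : Fin 8, coord i x = coord i y) : x = y := funext h

/-- The basis vectors `e₀ = 1, e₁, …, e₇`. -/
noncomputable def e (i : Fin 8) : Octonion := mk (Pi.single i 1)

/-- The coordinates of the octonion product, `eᵢ eⱼ = εᵢⱼₖ eₖ - δᵢⱼ` for `i, j ≥ 1`, where `ε` is the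
alternating symbol of `e¹²³ + e¹⁴⁵ + e¹⁶⁷ + e²⁴⁶ - e²⁵⁷ - e³⁴⁷ - e³⁵⁶`. -/
def mulCoord {R : Type} [CommRing R] (x y : Fin 8 → R) : Fin 8 → R := ![
  x 0 * y 0 - x 1 * y 1 - x 2 * y 2 - x 3 * y 3 - x 4 * y 4 - x 5 * y 5 - x 6 * y 6 - x 7 * y 7,
  x 0 * y 1 + x 1 * y 0 + x 2 * y 3 - x 3 * y 2 + x 4 * y 5 - x 5 * y 4 + x 6 * y 7 - x 7 * y 6,
  x 0 * y 2 - x 1 * y 3 + x 2 * y 0 + x 3 * y 1 + x 4 * y 6 - x 5 * y 7 - x 6 * y 4 + x 7 * y 5,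
  x 0 * y 3 + x 1 * y 2 - x 2 * y 1 + x 3 * y 0 - x 4 * y 7 - x 5 * y 6 + x 6 * y 5 + x 7 * y 4,
  x 0 * y 4 - x 1 * y 5 - x 2 * y 6 + x 3 * y 7 + x 4 * y 0 + x 5 * y 1 + x 6 * y 2 - x 7 * y 3,
  x 0 * y 5 + x 1 * y 4 + x 2 * y 7 + x 3 * y 6 - x 4 * y 1 + x 5 * y 0 - x 6 * y 3 - x 7 * y 2,
  x 0 * y 6 - x 1 * y 7 + x 2 * y 4 - x 3 * y 5 - x 4 * y 2 + x 5 * y 3 + x 6 * y 0 + x 7 * y 1,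
  x 0 * y 7 + x 1 * y 6 - x 2 * y 5 - x 3 * y 4 + x 4 * y 3 + x 5 * y 2 - x 6 * y 1 + x 7 * y 0]

section

variable {R : Type} [CommRing R] (x y : Fin 8 → R)

theorem mulCoord_0 : mulCoord x y 0 =
  x 0 * y 0 - x 1 * y 1 - x 2 * y 2 - x 3 * y 3 - x 4 * y 4 - x 5 * y 5 - x 6 * y 6 - x 7 * y 7 := rfl
theorem mulCoord_1 : mulCoord x y 1 =
  x 0 * y 1 + x 1 * y 0 + x 2 * y 3 - x 3 * y 2 + x 4 * y 5 - x 5 * y 4 + x 6 * y 7 - x 7 * y 6 := rfl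
theorem mulCoord_2 : mulCoord x y 2 =
  x 0 * y 2 - x 1 * y 3 + x 2 * y 0 + x 3 * y 1 + x 4 * y 6 - x 5 * y 7 - x 6 * y 4 + x 7 * y 5 := rfl
theorem mulCoord_3 : mulCoord x y 3 =
  x 0 * y 3 + x 1 * y 2 - x 2 * y 1 + x 3 * y 0 - x 4 * y 7 - x 5 * y 6 + x 6 * y 5 + x 7 * y 4 := rfl
theorem mulCoord_4 : mulCoord x y 4 =
  x 0 * y 4 - x 1 * y 5 - x 2 * y 6 + x 3 * y 7 + x 4 * y 0 + x 5 * y 1 + x 6 * y 2 - x 7 * y 3 := rfl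
theorem mulCoord_5 : mulCoord x y 5 =
  x 0 * y 5 + x 1 * y 4 + x 2 * y 7 + x 3 * y 6 - x 4 * y 1 + x 5 * y 0 - x 6 * y 3 - x 7 * y 2 := rfl
theorem mulCoord_6 : mulCoord x y 6 =
  x 0 * y 6 - x 1 * y 7 + x 2 * y 4 - x 3 * y 5 - x 4 * y 2 + x 5 * y 3 + x 6 * y 0 + x 7 * y 1 := rfl
theorem mulCoord_7 : mulCoord x y 7 =
  x 0 * y 7 + x 1 * y 6 - x 2 * y 5 - x 3 * y 4 + x 4 * y 3 + x 5 * y 2 - x 6 * y 1 + x 7 * y 0 := rfl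

end

theorem ext_cases {x y : Octonion} (h0 : coord 0 x = coord 0 y) (h1 : coord 1 x = coord 1 y)
    (h2 : coord 2 x = coord 2 y) (h3 : coord 3 x = coord 3 y) (h4 : coord 4 x = coord 4 y)
    (h5 : coord 5 x = coord 5 y) (h6 : coord 6 x = coord 6 y) (h7 : coord 7 x = coord 7 y) : x = y :=
  ext fun i => by fin_cases i <;> assumption

noncomputable instance : Mul Octonion :=
  ⟨fun x y => mk (mulCoord (fun i => coord i x) (fun i => coord i y))⟩
noncomputable instance : One Octonion := ⟨e 0⟩

theorem coord_mul (x y : Octonion) (i : Fin 8) :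
    coord i (x * y) = mulCoord (fun i => coord i x) (fun i => coord i y) i := rfl
theorem one_eq : (1 : Octonion) = e 0 := rfl
theorem coord_e (i j : Fin 8) : coord j (e i) = if j = i then 1 else 0 := by
  simp [e, Pi.single_apply]

theorem mul_add' (x y z : Octonion) : x * (y + z) = x * y + x * z := by
  apply ext_cases <;>
    simp only [coord_mul, map_add, mulCoord_0, mulCoord_1, mulCoord_2, mulCoord_3,
      mulCoord_4, mulCoord_5, mulCoord_6, mulCoord_7] <;> ring

theorem add_mul' (x y z : Octonion) : (x + y) * z = x * z + y * z := by
  apply ext_cases <;>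
    simp only [coord_mul, map_add, mulCoord_0, mulCoord_1, mulCoord_2, mulCoord_3,
      mulCoord_4, mulCoord_5, mulCoord_6, mulCoord_7] <;> ring

theorem one_mul' (x : Octonion) : 1 * x = x := ext fun i => by
  simp only [coord_mul, one_eq, coord_e]
  fin_cases i <;> simp [mulCoord]

theorem mul_one' (x : Octonion) : x * 1 = x := ext fun i => by
  simp only [coord_mul, one_eq, coord_e]
  fin_cases i <;> simp [mulCoord]

theorem smul_mul' (r : ℝ) (x y : Octonion) : (r • x) * y = r • (x * y) := by
  apply ext_cases <;>
    simp only [coord_mul, map_smul, smul_eq_mul, mulCoord_0, mulCoord_1, mulCoord_2, mulCoord_3,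
      mulCoord_4, mulCoord_5, mulCoord_6, mulCoord_7] <;> ring

theorem mul_smul' (r : ℝ) (x y : Octonion) : x * (r • y) = r • (x * y) := by
  apply ext_cases <;>
    simp only [coord_mul, map_smul, smul_eq_mul, mulCoord_0, mulCoord_1, mulCoord_2, mulCoord_3,
      mulCoord_4, mulCoord_5, mulCoord_6, mulCoord_7] <;> ring

theorem left_alt (x y : Octonion) : (x * x) * y = x * (x * y) := by
  apply ext_cases <;>
    simp only [coord_mul, mulCoord_0, mulCoord_1, mulCoord_2, mulCoord_3,
      mulCoord_4, mulCoord_5, mulCoord_6, mulCoord_7] <;> ring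

theorem right_alt (x y : Octonion) : (y * x) * x = y * (x * x) := by
  apply ext_cases <;>
    simp only [coord_mul, mulCoord_0, mulCoord_1, mulCoord_2, mulCoord_3,
      mulCoord_4, mulCoord_5, mulCoord_6, mulCoord_7] <;> ring

noncomputable instance : NonAssocRing Octonion where
  toAddCommGroup := inferInstance
  left_distrib := mul_add'
  right_distrib := add_mul'
  zero_mul x := by simpa using smul_mul' 0 0 x
  mul_zero x := by simpa using mul_smul' 0 x 0
  one_mul := one_mul'
  mul_one := mul_one'

instance : IsScalarTower ℝ Octonion Octonion := ⟨smul_mul'⟩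

instance : SMulCommClass ℝ Octonion Octonion := ⟨fun r x y => (mul_smul' r x y).symm⟩

/-- The conjugate `x₀ - ∑ xᵢ eᵢ`. -/
noncomputable def conj (x : Octonion) : Octonion :=
  mk fun i => if i = 0 then coord i x else -coord i x

/-- The sign in `eᵢ eⱼ = ± eₖ`. -/
def sgn : Fin 8 → Fin 8 → ℤ := ![
  ![1, 1, 1, 1, 1, 1, 1, 1], ![1, -1, 1, -1, 1, -1, 1, -1],
  ![1, -1, -1, 1, 1, -1, -1, 1], ![1, 1, -1, -1, -1, -1, 1, 1],
  ![1, -1, -1, 1, -1, 1, 1, -1], ![1, 1, 1, 1, -1, -1, -1, -1],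
  ![1, -1, 1, -1, -1, 1, -1, 1], ![1, 1, -1, -1, 1, 1, -1, -1]]

/-- The index `k` in `eᵢ eⱼ = ± eₖ`. -/
def idx : Fin 8 → Fin 8 → Fin 8 := ![
  ![0, 1, 2, 3, 4, 5, 6, 7], ![1, 0, 3, 2, 5, 4, 7, 6],
  ![2, 3, 0, 1, 6, 7, 4, 5], ![3, 2, 1, 0, 7, 6, 5, 4],
  ![4, 5, 6, 7, 0, 1, 2, 3], ![5, 4, 7, 6, 1, 0, 3, 2],
  ![6, 7, 4, 5, 2, 3, 0, 1], ![7, 6, 5, 4, 3, 2, 1, 0]]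

theorem mulCoord_single : ∀ i j k : Fin 8,
    mulCoord (R := ℤ) (fun l => if l = i then 1 else 0) (fun l => if l = j then 1 else 0) k =
      if k = idx i j then sgn i j else 0 := by
  decide

theorem mulCoord_cast (x y : Fin 8 → ℤ) (k : Fin 8) :
    mulCoord (R := ℝ) (fun l => (x l : ℝ)) (fun l => (y l : ℝ)) k = (mulCoord x y k : ℤ) := by
  fin_cases k <;> simp [mulCoord]

theorem e_mul (i j : Fin 8) : e i * e j = (sgn i j : ℝ) • e (idx i j) := ext fun k => by
  have h := mulCoord_cast (fun l => if l = i then 1 else 0) (fun l => if l = j then 1 else 0) k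
  rw [mulCoord_single] at h
  simp only [coord_mul, coord_e, map_smul, smul_eq_mul]
  push_cast at h
  rw [h]
  simp

theorem eq_sum (x : Octonion) : x = ∑ i, coord i x • e i := ext fun k => by
  simp [coord_e]

end Octonion

section Alternative

variable {A : Type*} [NonAssocRing A]

theorem assoc_skew₁ (hl : ∀ x y : A, (x * x) * y = x * (x * y)) (x y z : A) :
    associator x y z = -associator y x z := by
  have h1 := hl (x + y) z
  have h2 := hl x z
  have h3 := hl y z
  simp only [associator_apply, mul_add, add_mul] at *
  rw [h2, h3] at h1
  rw [← sub_eq_zero, ← sub_eq_zero.mpr h1]; abel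

theorem assoc_skew₂ (hr : ∀ x y : A, (y * x) * x = y * (x * x)) (x y z : A) :
    associator x y z = -associator x z y := by
  have h1 := hr (y + z) x
  have h2 := hr y x
  have h3 := hr z x
  simp only [associator_apply, mul_add, add_mul] at *
  rw [h2, h3] at h1
  rw [← sub_eq_zero, ← sub_eq_zero.mpr h1]; abel

/-- The Kleinfeld function. -/
def kleinfeld (w x y z : A) : A :=
  associator (w * x) y z - x * associator w y z - associator x y z * w

theorem assoc_cyc (hl : ∀ x y : A, (x * x) * y = x * (x * y))
    (hr : ∀ x y : A, (y * x) * x = y * (x * x)) (x y z : A) :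
    associator x y z = associator y z x := by
  rw [assoc_skew₁ hl x y z, assoc_skew₂ hr y x z, neg_neg]

theorem kleinfeld_cyc (hl : ∀ x y : A, (x * x) * y = x * (x * y))
    (hr : ∀ x y : A, (y * x) * x = y * (x * x)) (w x y z : A) :
    kleinfeld w x y z = -kleinfeld z w x y := by
  have c := assoc_cyc hl hr
  have t1 := associator_cocycle w x y z
  have t2 := associator_cocycle x y z w
  simp only [kleinfeld]
  rw [c w (x * y) z, c w x (y * z), c x (y * z) w] at t1
  rw [c x (y * z) w, c x y (z * w), c y (z * w) x, c y z w, c z w y] at t2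
  rw [c z x y, ← add_eq_zero_iff_eq_neg, ← neg_eq_zero, ← add_zero (0 : A)]
  nth_rewrite 1 [← t1]
  rw [← t2]
  abel

theorem kleinfeld_skew (hr : ∀ x y : A, (y * x) * x = y * (x * x)) (w x y z : A) :
    kleinfeld w x y z = -kleinfeld w x z y := by
  simp only [kleinfeld]
  rw [assoc_skew₂ hr (w * x) y z, assoc_skew₂ hr w y z, assoc_skew₂ hr x y z]
  simp only [mul_neg, neg_mul]
  abel

theorem kleinfeld_skew₁ (hl : ∀ x y : A, (x * x) * y = x * (x * y))
    (hr : ∀ x y : A, (y * x) * x = y * (x * x)) (w x y z : A) :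
    kleinfeld w x y z = -kleinfeld x w y z := by
  have c := kleinfeld_cyc hl hr
  rw [c w x y z, c z w x y, kleinfeld_skew hr y z w x, c y z x w, c w y z x]
  simp

/-- In an alternative ring, the commutator of an associator with an element. -/
theorem commutator_assoc (hl : ∀ x y : A, (x * x) * y = x * (x * y))
    (hr : ∀ x y : A, (y * x) * x = y * (x * x)) (a b c x : A) :
    associator (a * b) c x + associator (b * c) a x + associator (c * a) b x =
      associator a b c * x - x * associator a b c := by
  have cy := kleinfeld_cyc hl hr
  have C := assoc_cyc hl hr
  have k : kleinfeld c x a b = kleinfeld c a b x := by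
    rw [kleinfeld_skew₁ hl hr c x a b, cy x c a b, cy b x c a, cy a b x c]
    simp
  have t := associator_cocycle a b c x
  simp only [kleinfeld] at k
  rw [assoc_skew₁ hl a (b * c) x, C a b (c * x), C b (c * x) a] at t
  rw [assoc_skew₁ hl c b x, ← C b x a, ← C a b x, ← C b c a, ← C a b c] at k
  rw [← sub_eq_zero] at k
  have := congrArg₂ (· + ·) t k
  simp only [mul_neg] at this
  rw [← sub_eq_zero, ← neg_eq_zero, ← add_zero (0 : A), ← this]
  abel

theorem kleinfeld_self (hr : ∀ x y : A, (y * x) * x = y * (x * x)) (w x y : A) :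
    kleinfeld w x y y = 0 := by
  simp [kleinfeld, associator_apply, hr]

/-- `(x, xy, z) = (x, y, z) x`. -/
theorem assoc_mul₁ (hl : ∀ x y : A, (x * x) * y = x * (x * y))
    (hr : ∀ x y : A, (y * x) * x = y * (x * x)) (x y z : A) :
    associator x (x * y) z = associator x y z * x := by
  have C := assoc_cyc hl hr
  have h : kleinfeld x y z x = 0 := by
    rw [← neg_eq_zero, ← kleinfeld_cyc hl hr, kleinfeld_self hr]
  have h0 : associator x z x = 0 := by
    rw [C, associator_apply, hr, sub_self]
  rw [kleinfeld, h0, mul_zero, sub_zero, sub_eq_zero] at h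
  rw [C, h, ← C x y z]

/-- `(x, yx, z) = x (x, y, z)`. -/
theorem assoc_mul₂ (hl : ∀ x y : A, (x * x) * y = x * (x * y))
    (hr : ∀ x y : A, (y * x) * x = y * (x * x)) (x y z : A) :
    associator x (y * x) z = x * associator x y z := by
  have s1 := assoc_skew₁ hl
  have h : kleinfeld y x x z = 0 := by
    rw [kleinfeld_cyc hl hr, kleinfeld_self hr, neg_zero]
  have h0 : associator x x z = 0 := by rw [associator_apply, hl, sub_self]
  rw [kleinfeld, h0, zero_mul, sub_zero, sub_eq_zero] at h
  rw [s1, h, s1 y x z, mul_neg, neg_neg]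

theorem moufang_left (hl : ∀ x y : A, (x * x) * y = x * (x * y))
    (hr : ∀ x y : A, (y * x) * x = y * (x * x)) (x y z : A) :
    (x * y * x) * z = x * (y * (x * z)) := by
  have h1 := assoc_mul₁ hl hr x y z
  have h2 := assoc_mul₁ hl hr x z y
  rw [assoc_skew₁ hl] at h1
  rw [assoc_skew₂ hr, assoc_skew₂ hr x z y, neg_mul, neg_inj, ← h1] at h2
  simp only [associator_apply] at h2
  rw [← sub_eq_zero, ← sub_eq_zero.mpr h2]
  abel

theorem moufang_right (hl : ∀ x y : A, (x * x) * y = x * (x * y))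
    (hr : ∀ x y : A, (y * x) * x = y * (x * x)) (x y z : A) :
    z * (x * y * x) = ((z * x) * y) * x := by
  have h1 : associator z (x * y) x = -(associator z x y * x) := by
    rw [assoc_cyc hl hr z, assoc_cyc hl hr (x * y), assoc_skew₂ hr, assoc_mul₁ hl hr,
      assoc_cyc hl hr z x y]
  simp only [associator_apply, sub_mul] at h1
  rw [← sub_eq_zero, ← neg_zero (G := A), ← sub_eq_zero.mpr h1]
  abel

theorem moufang_middle (hl : ∀ x y : A, (x * x) * y = x * (x * y))
    (hr : ∀ x y : A, (y * x) * x = y * (x * x)) (x y z : A) :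
    (x * y) * (z * x) = x * (y * z) * x := by
  have h1 := assoc_mul₂ hl hr x z y
  rw [assoc_skew₂ hr, assoc_skew₂ hr x z y, mul_neg, neg_inj, assoc_cyc hl hr x y z] at h1
  have h0 : associator x (y * z) x = 0 := by
    rw [assoc_skew₁ hl, associator_apply, hr, sub_self, neg_zero]
  simp only [associator_apply, mul_sub] at h1 h0
  rw [← sub_eq_zero, ← add_zero (0 : A)]
  nth_rewrite 1 [← sub_eq_zero.mpr h1]
  rw [← neg_zero (G := A), ← h0]
  abel

end Alternative
set_option linter.unusedSectionVars false

/-- An `𝕆`-bimodule: a real vector space `M` with real bilinear unital left and right multiplications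
such that the left associator is alternating and `[p, q, m] = [m, p, q] = [q, m, p]`. -/
class OctBimodule (M : Type*) [AddCommGroup M] [Module ℝ M] where
  /-- `lsmul p m` is the product `p m`. -/
  lsmul : Octonion →ₗ[ℝ] M →ₗ[ℝ] M
  /-- `rsmul p m` is the product `m p`. -/
  rsmul : Octonion →ₗ[ℝ] M →ₗ[ℝ] M
  one_lsmul : ∀ m, lsmul 1 m = m
  one_rsmul : ∀ m, rsmul 1 m = m
  left_alt : ∀ p q m, lsmul (p * q) m - lsmul p (lsmul q m) =
    -(lsmul (q * p) m - lsmul q (lsmul p m))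
  assoc_right : ∀ p q m, lsmul (p * q) m - lsmul p (lsmul q m) =
    rsmul q (rsmul p m) - rsmul (p * q) m
  assoc_middle : ∀ p q m, lsmul (p * q) m - lsmul p (lsmul q m) =
    rsmul p (lsmul q m) - lsmul q (rsmul p m)

/-- `p •ₗ m` is the product `p m` in a bimodule. -/
notation:73 p:74 " •ₗ " m:73 => OctBimodule.lsmul p m
/-- `m •ᵣ p` is the product `m p` in a bimodule. -/
notation:73 m:73 " •ᵣ " p:74 => OctBimodule.rsmul p m

open Octonion

section Bimodule

variable {M : Type*} [AddCommGroup M] [Module ℝ M] [OctBimodule M]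

/-- The left associator `[p, q, m] = (pq)m - p(qm)`. -/
noncomputable def lassoc (p q : Octonion) (m : M) : M := (p * q) •ₗ m - p •ₗ (q •ₗ m)

/-- The split null extension `𝕆 ⊕ M`, an alternative ring. -/
def NullExt (M : Type*) : Type _ := Octonion × M

namespace NullExt

noncomputable instance : AddCommGroup (NullExt M) := inferInstanceAs (AddCommGroup (Octonion × M))

noncomputable instance : Mul (NullExt M) :=
  ⟨fun x y => (x.1 * y.1, x.1 •ₗ y.2 + x.2 •ᵣ y.1)⟩

noncomputable instance : One (NullExt M) := ⟨((1 : Octonion), (0 : M))⟩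

theorem ext {x y : NullExt M} (h₁ : x.1 = y.1) (h₂ : x.2 = y.2) : x = y := Prod.ext h₁ h₂

@[simp] theorem mul_fst (x y : NullExt M) : (x * y).1 = x.1 * y.1 := rfl
@[simp] theorem mul_snd (x y : NullExt M) : (x * y).2 = x.1 •ₗ y.2 + x.2 •ᵣ y.1 := rfl
@[simp] theorem add_fst (x y : NullExt M) : (x + y).1 = x.1 + y.1 := rfl
@[simp] theorem add_snd (x y : NullExt M) : (x + y).2 = x.2 + y.2 := rfl
@[simp] theorem sub_fst (x y : NullExt M) : (x - y).1 = x.1 - y.1 := rfl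
@[simp] theorem sub_snd (x y : NullExt M) : (x - y).2 = x.2 - y.2 := rfl
@[simp] theorem neg_fst (x : NullExt M) : (-x).1 = -x.1 := rfl
@[simp] theorem neg_snd (x : NullExt M) : (-x).2 = -x.2 := rfl
@[simp] theorem zero_fst : (0 : NullExt M).1 = 0 := rfl
@[simp] theorem zero_snd : (0 : NullExt M).2 = 0 := rfl
@[simp] theorem one_fst : (1 : NullExt M).1 = 1 := rfl
@[simp] theorem one_snd : (1 : NullExt M).2 = 0 := rfl

noncomputable instance : NonAssocRing (NullExt M) where
  toAddCommGroup := inferInstance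
  left_distrib x y z := ext (by simp [mul_add]) (by simp; abel)
  right_distrib x y z := ext (by simp [add_mul]) (by simp; abel)
  zero_mul x := ext (by simp) (by simp)
  mul_zero x := ext (by simp) (by simp)
  one_mul x := ext (by simp) (by simp [OctBimodule.one_lsmul])
  mul_one x := ext (by simp) (by simp [OctBimodule.one_rsmul])

theorem left_alt (x y : NullExt M) : (x * x) * y = x * (x * y) := by
  refine ext (Octonion.left_alt _ _) ?_
  have h1 := OctBimodule.left_alt x.1 x.1 y.2
  have h2 := OctBimodule.assoc_right x.1 y.1 x.2
  have h3 := OctBimodule.assoc_middle y.1 x.1 x.2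
  have h4 := OctBimodule.left_alt x.1 y.1 x.2
  have h1' : (x.1 * x.1) •ₗ y.2 - x.1 •ₗ (x.1 •ₗ y.2) = 0 := by
    have h5 := add_eq_zero_iff_eq_neg.mpr h1
    rw [← two_smul ℝ] at h5
    exact (smul_eq_zero.mp h5).resolve_left two_ne_zero
  simp only [mul_fst, mul_snd, map_add]
  rw [← sub_eq_zero]
  have : (x.1 * x.1) •ₗ y.2 + (x.1 •ₗ x.2 + x.2 •ᵣ x.1) •ᵣ y.1 -
     (x.1 •ₗ (x.1 •ₗ y.2) + x.1 •ₗ (x.2 •ᵣ y.1) + x.2 •ᵣ (x.1 * y.1))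
     = ((x.1 * x.1) •ₗ y.2 - x.1 •ₗ (x.1 •ₗ y.2)) + 
       ((x.1 •ₗ x.2) •ᵣ y.1 - x.1 •ₗ (x.2 •ᵣ y.1)) + 
       ((x.2 •ᵣ x.1) •ᵣ y.1 - x.2 •ᵣ (x.1 * y.1)) := by
    rw [map_add]; abel
  rw [map_add] at this
  rw [this, h1', ← h3, ← h2, h4]
  abel

theorem right_alt (x y : NullExt M) : (y * x) * x = y * (x * x) := by
  refine ext (Octonion.right_alt _ _) ?_
  have h1 := OctBimodule.left_alt x.1 x.1 y.2
  have h2 := OctBimodule.assoc_right x.1 x.1 y.2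
  have h3 := OctBimodule.assoc_middle x.1 y.1 x.2
  have h4 := OctBimodule.left_alt x.1 y.1 x.2
  have h1' : (x.1 * x.1) •ₗ y.2 - x.1 •ₗ (x.1 •ₗ y.2) = 0 := by
    have h5 := add_eq_zero_iff_eq_neg.mpr h1
    rw [← two_smul ℝ] at h5
    exact (smul_eq_zero.mp h5).resolve_left two_ne_zero
  rw [h1'] at h2
  simp only [mul_fst, mul_snd, map_add]
  rw [← sub_eq_zero]
  have : (y.1 * x.1) •ₗ x.2 + ((y.1 •ₗ x.2) •ᵣ x.1 + (y.2 •ᵣ x.1) •ᵣ x.1) -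
      (y.1 •ₗ (x.1 •ₗ x.2) + y.1 •ₗ (x.2 •ᵣ x.1) + y.2 •ᵣ (x.1 * x.1))
     = ((y.1 * x.1) •ₗ x.2 - y.1 •ₗ (x.1 •ₗ x.2)) + 
       ((y.1 •ₗ x.2) •ᵣ x.1 - y.1 •ₗ (x.2 •ᵣ x.1)) + 
       ((y.2 •ᵣ x.1) •ᵣ x.1 - y.2 •ᵣ (x.1 * x.1)) := by
    abel
  rw [this, ← h3, ← h2, h4]
  abel

/-- The inclusion of `𝕆`. -/
noncomputable def inl (p : Octonion) : NullExt M := (p, (0 : M))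
/-- The inclusion of `M`. -/
noncomputable def inr (m : M) : NullExt M := ((0 : Octonion), m)

@[simp] theorem inl_fst (p : Octonion) : (inl p : NullExt M).1 = p := rfl
@[simp] theorem inl_snd (p : Octonion) : (inl p : NullExt M).2 = 0 := rfl
@[simp] theorem inr_fst (m : M) : (inr m : NullExt M).1 = 0 := rfl
@[simp] theorem inr_snd (m : M) : (inr m : NullExt M).2 = m := rfl

end NullExt

open NullExt

theorem moufang₁ (p q : Octonion) (x : M) : ((p •ₗ x) •ᵣ p) •ᵣ q = p •ₗ (x •ᵣ (p * q)) := by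
  simpa using congrArg Prod.snd
    (moufang_left NullExt.left_alt NullExt.right_alt (inl p) (inr x) (inl q))

theorem moufang₂ (p q : Octonion) (x : M) : (p * q) •ₗ (x •ᵣ p) = (p •ₗ (q •ₗ x)) •ᵣ p := by
  simpa using congrArg Prod.snd
    (moufang_middle NullExt.left_alt NullExt.right_alt (inl p) (inl q) (inr x))

theorem lsmul_lsmul_swap (p q : Octonion) (x : M) :
    p •ₗ (q •ₗ x) = (p * q + q * p) •ₗ x - q •ₗ (p •ₗ x) := by
  have h := OctBimodule.left_alt p q x
  rw [← sub_eq_zero] at h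
  rw [← sub_eq_zero, ← neg_eq_zero, ← h, map_add, LinearMap.add_apply]
  abel

theorem middle_assoc (p w : Octonion) (x : M) :
    (p •ₗ (w •ₗ x)) •ᵣ w - p •ₗ ((w •ₗ x) •ᵣ w) = -(lassoc p w x •ᵣ w) := by
  have h : associator (inl p) (inl w * inr x) (inl w) =
      -(associator (inl p) (inl w) (inr x) * (inl w : NullExt M)) := by
    rw [← assoc_cyc NullExt.left_alt NullExt.right_alt (inl w), assoc_skew₂ NullExt.right_alt,
      assoc_mul₁ NullExt.left_alt NullExt.right_alt,
      ← assoc_cyc NullExt.left_alt NullExt.right_alt (inl p)]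
  simpa [associator_apply, lassoc] using congrArg Prod.snd h

theorem lassoc_pair (u v : Octonion) (hu : u * u = -1) (hv : v * v = -1) (huv : u * v = -(v * u))
    (x : M) : lassoc (u * v) u x •ᵣ u + lassoc (u * v) v x •ᵣ v = (2 : ℝ) • lassoc u v x := by
  have H : ∀ w z : Octonion, lassoc w (w * z) x = lassoc w z x •ᵣ w := fun w z => by
    simpa [associator_apply, lassoc] using congrArg Prod.snd
      (assoc_mul₁ NullExt.left_alt NullExt.right_alt (inl w) (inl z) (inr x))
  have S : ∀ p q : Octonion, lassoc p q x = -lassoc q p x := fun p q =>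
    OctBimodule.left_alt p q x
  have Q : ∀ w : Octonion, w * w = -1 → ∀ y : M, (y •ᵣ w) •ᵣ w = -y := fun w hw y => by
    have := congrArg Prod.snd (NullExt.right_alt (inl w) (inr y))
    simpa [hw, OctBimodule.one_rsmul] using this
  have N : ∀ p q : Octonion, lassoc p (-q) x = -lassoc p q x := fun p q => by
    simp [lassoc]; abel
  rw [S (u * v) u, H, S (u * v) v, huv, N, H, S v u]
  simp only [map_neg, neg_neg]
  rw [Q u hu, Q v hv, two_smul]
  abel

theorem lassoc_commutator (a b c : Octonion) (x : M) :
    lassoc (a * b) c x + lassoc (b * c) a x + lassoc (c * a) b x =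
      associator a b c •ₗ x - x •ᵣ associator a b c := by
  simpa [associator_apply, lassoc] using congrArg Prod.snd
    (commutator_assoc NullExt.left_alt NullExt.right_alt (inl a) (inl b) (inl c) (inr x))

end Bimodule
set_option linter.unusedSectionVars false
set_option linter.unusedSimpArgs false
open Octonion
section RealPart

variable {M : Type*} [AddCommGroup M] [Module ℝ M] [OctBimodule M]

/-- The nucleus of `M`, i.e. the set of associative elements. It is the real part `Re M`. -/
noncomputable def nucleus (M : Type*) [AddCommGroup M] [Module ℝ M] [OctBimodule M] :
    Submodule ℝ M where
  carrier := {m | ∀ p q, lassoc p q m = 0}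
  zero_mem' p q := by simp [lassoc]
  add_mem' {x y} hx hy p q := by
    have h1 := hx p q
    have h2 := hy p q
    simp only [lassoc, map_add] at *
    rw [add_sub_add_comm, h1, h2, add_zero]
  smul_mem' r x hx p q := by
    have h1 := hx p q
    simp only [lassoc, map_smul] at *
    rw [← smul_sub, h1, smul_zero]

/-- The operator `x ↦ ∑ (eᵢ x) eᵢ`, with `i = 0, …, 7`. -/
noncomputable def sandwich : M →ₗ[ℝ] M :=
  ∑ i : Fin 8, (OctBimodule.rsmul (M := M) (e i)) ∘ₗ (OctBimodule.lsmul (e i))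

theorem sandwich_apply (x : M) : sandwich x = ∑ i : Fin 8, (e i •ₗ x) •ᵣ e i := by
  simp [sandwich]

theorem e_zero_lsmul (x : M) : e 0 •ₗ x = x := OctBimodule.one_lsmul x
theorem e_zero_rsmul (x : M) : x •ᵣ e 0 = x := OctBimodule.one_rsmul x

theorem sandwich_lsmul (k : Fin 8) (hk : k ≠ 0) (x : M) :
    sandwich (e k •ₗ x) = -(sandwich x •ᵣ e k) := by
  simp only [sandwich_apply, ← moufang₂, map_sum, moufang₁]
  fin_cases k
  · exact absurd rfl hk
  all_goals
    simp [Fin.sum_univ_eight, e_mul, sgn, idx]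
    abel

theorem sandwich_lsmul' (k : Fin 8) (hk : k ≠ 0) (x : M) :
    sandwich (e k •ₗ x) = -(e k •ₗ sandwich x) + (∑ i, lassoc (e k) (e i) x •ᵣ e i)
      + (2 : ℝ) • (e k •ₗ x - x •ᵣ e k) := by
  have h : ∀ i, (e i •ₗ (e k •ₗ x)) •ᵣ e i = ((e i * e k + e k * e i) •ₗ x) •ᵣ e i
      - e k •ₗ ((e i •ₗ x) •ᵣ e i) + lassoc (e k) (e i) x •ᵣ e i := fun i => by
    have := middle_assoc (e k) (e i) x
    rw [sub_eq_iff_eq_add] at this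
    rw [lsmul_lsmul_swap, map_sub, this]
    abel
  have h2 : ∑ i, ((e i * e k + e k * e i) •ₗ x) •ᵣ e i = (2 : ℝ) • (e k •ₗ x - x •ᵣ e k) := by
    fin_cases k
    · exact absurd rfl hk
    all_goals
      simp [Fin.sum_univ_eight, e_mul, sgn, idx, e_zero_lsmul, e_zero_rsmul]
      module
  simp only [sandwich_apply, h, Finset.sum_add_distrib, Finset.sum_sub_distrib, h2, map_sum]
  abel

theorem lassoc_smul (r : ℝ) (p q : Octonion) (x : M) : lassoc p (r • q) x = r • lassoc p q x := by
  simp [lassoc, smul_sub, mul_smul_comm]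

theorem lassoc_neg (p q : Octonion) (x : M) : lassoc p (-q) x = -lassoc p q x := by
  simp [lassoc]; abel

theorem lassoc_self (p : Octonion) (x : M) : lassoc p p x = 0 := by
  have h := add_eq_zero_iff_eq_neg.mpr (OctBimodule.left_alt p p x)
  rw [← two_smul ℝ] at h
  exact (smul_eq_zero.mp h).resolve_left two_ne_zero

theorem lassoc_one (p : Octonion) (x : M) : lassoc p (e 0) x = 0 := by
  rw [lassoc, ← one_eq, mul_one, OctBimodule.one_lsmul, sub_self]

theorem triple_sum (a b c k : Octonion) (hab : (a * b) * c = k) (hbc : (b * c) * a = k)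
    (hca : (c * a) * b = k) (habc : a * (b * c) = -k)
    (ha : a * a = -1) (hb : b * b = -1) (hc : c * c = -1)
    (hab2 : (a * b) * (a * b) = -1) (hbc2 : (b * c) * (b * c) = -1) (hca2 : (c * a) * (c * a) = -1)
    (s1 : (a * b) * c = -(c * (a * b))) (s2 : (b * c) * a = -(a * (b * c)))
    (s3 : (c * a) * b = -(b * (c * a))) (x : M) :
    lassoc k (a * b) x •ᵣ (a * b) + lassoc k c x •ᵣ c + (lassoc k (b * c) x •ᵣ (b * c)
      + lassoc k a x •ᵣ a) + (lassoc k (c * a) x •ᵣ (c * a) + lassoc k b x •ᵣ b) =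
      (4 : ℝ) • (k •ₗ x - x •ᵣ k) := by
  have h := lassoc_commutator a b c x
  have p1 := lassoc_pair _ _ hab2 hc s1 x
  have p2 := lassoc_pair _ _ hbc2 ha s2 x
  have p3 := lassoc_pair _ _ hca2 hb s3 x
  rw [hab] at p1
  rw [hbc] at p2
  rw [hca] at p3
  have hk : associator a b c = (2 : ℝ) • k := by
    rw [associator_apply, hab, habc, sub_neg_eq_add, two_smul]
  rw [hk] at h
  rw [p1, p2, p3, ← smul_add, ← smul_add, h]
  simp only [map_smul, LinearMap.smul_apply]
  module

theorem sum_lassoc (k : Fin 8) (hk : k ≠ 0) (x : M) :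
    ∑ i, lassoc (e k) (e i) x •ᵣ e i = (4 : ℝ) • (e k •ₗ x - x •ᵣ e k) := by
  have key : ∃ a b c : Fin 8, (e a * e b) * e c = e k ∧ (e b * e c) * e a = e k ∧
      (e c * e a) * e b = e k ∧ e a * (e b * e c) = -e k ∧
      e a * e a = -1 ∧ e b * e b = -1 ∧ e c * e c = -1 ∧ (e a * e b) * (e a * e b) = -1 ∧
      (e b * e c) * (e b * e c) = -1 ∧ (e c * e a) * (e c * e a) = -1 ∧
      (e a * e b) * e c = -(e c * (e a * e b)) ∧ (e b * e c) * e a = -(e a * (e b * e c)) ∧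
      (e c * e a) * e b = -(e b * (e c * e a)) ∧
      ∑ i, lassoc (e k) (e i) x •ᵣ e i = lassoc (e k) (e a * e b) x •ᵣ (e a * e b)
        + lassoc (e k) (e c) x •ᵣ e c + (lassoc (e k) (e b * e c) x •ᵣ (e b * e c)
        + lassoc (e k) (e a) x •ᵣ e a) + (lassoc (e k) (e c * e a) x •ᵣ (e c * e a)
        + lassoc (e k) (e b) x •ᵣ e b) := by
    fin_cases k
    · exact absurd rfl hk
    · refine ⟨2, 4, 7, ?_⟩
      simp [Fin.sum_univ_eight, e_mul, sgn, idx, one_eq, lassoc_neg, lassoc_self, lassoc_one]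
      abel
    · refine ⟨1, 6, 5, ?_⟩
      simp [Fin.sum_univ_eight, e_mul, sgn, idx, one_eq, lassoc_neg, lassoc_self, lassoc_one]
      abel
    · refine ⟨1, 5, 7, ?_⟩
      simp [Fin.sum_univ_eight, e_mul, sgn, idx, one_eq, lassoc_neg, lassoc_self, lassoc_one]
      abel
    · refine ⟨1, 2, 7, ?_⟩
      simp [Fin.sum_univ_eight, e_mul, sgn, idx, one_eq, lassoc_neg, lassoc_self, lassoc_one]
      abel
    · refine ⟨1, 2, 6, ?_⟩
      simp [Fin.sum_univ_eight, e_mul, sgn, idx, one_eq, lassoc_neg, lassoc_self, lassoc_one]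
      abel
    · refine ⟨1, 4, 3, ?_⟩
      simp [Fin.sum_univ_eight, e_mul, sgn, idx, one_eq, lassoc_neg, lassoc_self, lassoc_one]
      abel
    · refine ⟨1, 3, 5, ?_⟩
      simp [Fin.sum_univ_eight, e_mul, sgn, idx, one_eq, lassoc_neg, lassoc_self, lassoc_one]
      abel
  obtain ⟨a, b, c, h1, h2, h3, h4, h5, h6, h7, h8, h9, h10, h11, h12, h13, h⟩ := key
  rw [h]
  exact triple_sum _ _ _ _ h1 h2 h3 h4 h5 h6 h7 h8 h9 h10 h11 h12 h13 x

/-- `sandwich` is `6` on commutators, in the form needed for the centrality of real parts. -/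
theorem sandwich_comm (k : Fin 8) (hk : k ≠ 0) (x : M) :
    e k •ₗ sandwich x - sandwich x •ᵣ e k = (6 : ℝ) • (e k •ₗ x - x •ᵣ e k) := by
  have h1 := sandwich_lsmul k hk x
  rw [sandwich_lsmul' k hk x, sum_lassoc k hk x, ← sub_eq_zero] at h1
  rw [← sub_eq_zero, ← neg_eq_zero, ← h1]
  module

theorem sandwich_eq (x : M) :
    sandwich x = (-6 : ℝ) • x - ∑ i : Fin 7, e i.succ •ₗ (e i.succ •ₗ x - x •ᵣ e i.succ) := by
  have hm : ∀ i : Fin 8, e i •ₗ (x •ᵣ e i) = (e i •ₗ x) •ᵣ e i := fun i => by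
    have h2 := OctBimodule.assoc_middle (e i) (e i) x
    have h3 := lassoc_self (e i) x
    rw [lassoc] at h3
    rw [h3] at h2
    rw [← sub_eq_zero, ← neg_eq_zero, h2]; abel
  have hs : ∀ i : Fin 7, e i.succ •ₗ (e i.succ •ₗ x) = -x := fun i => by
    have h3 := lassoc_self (e i.succ) x
    rw [lassoc, sub_eq_zero] at h3
    rw [← h3]
    have : e i.succ * e i.succ = -1 := by
      fin_cases i <;> simp [e_mul, sgn, idx, one_eq]
    rw [this, map_neg, LinearMap.neg_apply, OctBimodule.one_lsmul]
  rw [sandwich_apply, Fin.sum_univ_succ, e_zero_lsmul, e_zero_rsmul]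
  simp only [map_sub, hm, hs, Finset.sum_sub_distrib]
  simp
  module

/-- The real part operator `Re x = (5/12) x - (1/12) ∑ᵢ eᵢ x eᵢ`, with `i = 1, …, 7`; it is the projection
of `M = ⨁ eᵢ Re M` onto `Re M`, see `reOp_mem`, `reOp_e_lsmul` and `eq_sum_reOp`. -/
noncomputable def reOp : M →ₗ[ℝ] M :=
  (5 / 12 : ℝ) • LinearMap.id - (1 / 12 : ℝ) • ∑ i : Fin 7,
    (OctBimodule.rsmul (M := M) (e i.succ)) ∘ₗ (OctBimodule.lsmul (e i.succ))

theorem reOp_eq (x : M) : reOp x = (1 / 2 : ℝ) • x - (1 / 12 : ℝ) • sandwich x := by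
  rw [sandwich_apply, Fin.sum_univ_succ, e_zero_lsmul, e_zero_rsmul]
  simp [reOp]
  module

theorem reOp_central (p : Octonion) (x : M) : p •ₗ reOp x = reOp x •ᵣ p := by
  have h : ∀ k : Fin 8, e k •ₗ reOp x = reOp x •ᵣ e k := fun k => by
    by_cases hk : k = 0
    · rw [hk, e_zero_lsmul, e_zero_rsmul]
    · have := sub_eq_zero.mpr (sandwich_comm k hk x)
      rw [reOp_eq, ← sub_eq_zero]
      simp only [map_sub, map_smul]
      have h2 := congrArg (fun y => (-(1 / 12 : ℝ)) • y) this
      simp only [smul_zero] at h2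
      rw [← h2]
      module
  rw [eq_sum p]
  simp only [map_sum, map_smul, LinearMap.sum_apply, LinearMap.smul_apply, h]

/-- A central element is associative. -/
theorem mem_nucleus_of_central (x : M) (h : ∀ p : Octonion, p •ₗ x = x •ᵣ p) : x ∈ nucleus M := by
  intro p q
  have h1 : lassoc p q x = _ := OctBimodule.assoc_right p q x
  have h2 : lassoc p q x = (p * q) •ₗ x - p •ₗ (q •ₗ x) := rfl
  have h3 : lassoc q p x = _ := OctBimodule.assoc_middle q p x
  rw [← h, ← h] at h1
  rw [← h] at h3
  have h4 : lassoc p q x = -lassoc q p x := OctBimodule.left_alt p q x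
  have h5 : (3 : ℝ) • lassoc p q x = 0 := by
    have : (3 : ℝ) • lassoc p q x = lassoc p q x + lassoc p q x + lassoc p q x := by module
    rw [this]
    nth_rewrite 3 [h4]
    rw [h3]
    nth_rewrite 1 [h1]
    rw [h2]
    abel
  exact (smul_eq_zero.mp h5).resolve_left three_ne_zero

/-- Associative elements are central. -/
theorem nucleus_central (p : Octonion) {x : M} (hx : x ∈ nucleus M) : p •ₗ x = x •ᵣ p := by
  have hx' : ∀ p q, lassoc p q x = 0 := hx
  have h : ∀ k : Fin 8, e k •ₗ x = x •ᵣ e k := fun k => by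
    by_cases hk : k = 0
    · rw [hk, e_zero_lsmul, e_zero_rsmul]
    · have := sum_lassoc k hk x
      simp only [hx', map_zero, Finset.sum_const_zero] at this
      exact sub_eq_zero.mp ((smul_eq_zero.mp this.symm).resolve_left four_ne_zero)
  rw [eq_sum p]
  simp only [map_sum, map_smul, LinearMap.sum_apply, LinearMap.smul_apply, h]

theorem reOp_mem (x : M) : reOp x ∈ nucleus M := mem_nucleus_of_central _ fun p => reOp_central p x

theorem nucleus_mul {x : M} (hx : x ∈ nucleus M) (p q : Octonion) :
    p •ₗ (q •ₗ x) = (p * q) •ₗ x := (sub_eq_zero.mp (hx p q)).symm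

theorem nucleus_mul_right {x : M} (hx : x ∈ nucleus M) (p q : Octonion) :
    (p •ₗ x) •ᵣ q = (p * q) •ₗ x := by
  have hx' : ∀ p q, lassoc p q x = 0 := hx
  have h : lassoc q p x = _ := OctBimodule.assoc_middle q p x
  rw [hx' q p, ← nucleus_central q hx, nucleus_mul hx] at h
  exact sub_eq_zero.mp h.symm

theorem reOp_e_lsmul {x : M} (hx : x ∈ nucleus M) (i : Fin 8) :
    reOp (e i •ₗ x) = if i = 0 then x else 0 := by
  rw [reOp_eq, sandwich_apply]
  simp only [nucleus_mul hx, nucleus_mul_right hx]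
  fin_cases i <;> simp [Fin.sum_univ_eight, e_mul, sgn, idx, e_zero_lsmul] <;> module

theorem reOp_lsmul {x : M} (hx : x ∈ nucleus M) (p : Octonion) :
    reOp (p •ₗ x) = coord 0 p • x := by
  conv_lhs => rw [eq_sum p]
  simp [reOp_e_lsmul hx]

theorem reOp_of_mem {x : M} (hx : x ∈ nucleus M) : reOp x = x := by
  simpa [e_zero_lsmul] using reOp_e_lsmul hx 0

theorem conj_e_zero : conj (e 0) = e 0 := ext fun i => by
  fin_cases i <;> simp [conj, coord_e]

theorem conj_e_succ (i : Fin 7) : conj (e i.succ) = -e i.succ := ext fun j => by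
  by_cases hj : j = 0
  · subst hj; simp [conj, coord_e, (Fin.succ_ne_zero i).symm]
  · simp [conj, hj]

/-- The decomposition `M = ⨁ eᵢ Re M`. -/
theorem eq_sum_reOp (x : M) : ∑ i : Fin 8, e i •ₗ reOp (conj (e i) •ₗ x) = x := by
  have h1 : ∀ i : Fin 7, e i.succ •ₗ reOp (conj (e i.succ) •ₗ x) =
      (1 / 2 : ℝ) • x - (1 / 12 : ℝ) • (e i.succ •ₗ (sandwich x •ᵣ e i.succ)) := fun i => by
    have h3 := lassoc_self (e i.succ) x
    rw [lassoc, sub_eq_zero] at h3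
    have : e i.succ * e i.succ = -1 := by
      fin_cases i <;> simp [e_mul, sgn, idx, one_eq]
    rw [this, map_neg, LinearMap.neg_apply, OctBimodule.one_lsmul] at h3
    rw [conj_e_succ, map_neg, LinearMap.neg_apply, map_neg, reOp_eq, sandwich_lsmul _ i.succ_ne_zero]
    simp only [map_neg, map_sub, map_smul, smul_neg, ← h3]
    abel
  have h2 : ∀ i : Fin 7, e i.succ •ₗ (sandwich x •ᵣ e i.succ) =
      -sandwich x - (6 : ℝ) • (e i.succ •ₗ (e i.succ •ₗ x - x •ᵣ e i.succ)) := fun i => by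
    have h3 := lassoc_self (e i.succ) (sandwich x)
    rw [lassoc, sub_eq_zero] at h3
    have : e i.succ * e i.succ = -1 := by
      fin_cases i <;> simp [e_mul, sgn, idx, one_eq]
    rw [this, map_neg, LinearMap.neg_apply, OctBimodule.one_lsmul] at h3
    rw [← map_smul, ← sandwich_comm _ i.succ_ne_zero, map_sub, ← h3]
    abel
  have h4 : ∑ i : Fin 7, e i.succ •ₗ (e i.succ •ₗ x - x •ᵣ e i.succ) =
      (-6 : ℝ) • x - sandwich x := by
    rw [sandwich_eq x]; abel
  rw [Fin.sum_univ_succ, conj_e_zero, e_zero_lsmul, e_zero_lsmul, reOp_eq]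
  simp only [h1, h2, Finset.sum_sub_distrib, ← Finset.smul_sum, h4]
  simp
  module

theorem reOp_lassoc (p q : Octonion) (x : M) : reOp (lassoc p q x) = 0 := by
  have hc : ∀ a b c : Octonion, coord 0 (a * b * c) = coord 0 (a * (b * c)) := fun a b c => by
    simp [coord_mul, mulCoord]; ring
  rw [lassoc, ← eq_sum_reOp x]
  simp only [map_sum, map_sub]
  rw [← Finset.sum_sub_distrib]
  refine Finset.sum_eq_zero fun i _ => ?_
  have hn := reOp_mem (conj (e i) •ₗ x)
  rw [nucleus_mul hn, nucleus_mul hn, nucleus_mul hn, reOp_lsmul hn, reOp_lsmul hn, hc, sub_self]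

theorem reOp_comm (p : Octonion) (x : M) : reOp (p •ₗ x) = reOp (x •ᵣ p) := by
  have hc : ∀ a b : Octonion, coord 0 (a * b) = coord 0 (b * a) := fun a b => by
    simp [coord_mul, mulCoord]; ring
  rw [← eq_sum_reOp x]
  simp only [map_sum]
  refine Finset.sum_congr rfl fun i _ => ?_
  have hn := reOp_mem (conj (e i) •ₗ x)
  rw [nucleus_mul hn, nucleus_mul_right hn, reOp_lsmul hn, reOp_lsmul hn, hc]

theorem eq_zero_of_reOp_lsmul {x : M} (h : ∀ p, reOp (p •ₗ x) = 0) : x = 0 := by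
  rw [← eq_sum_reOp x]; simp [h]

end RealPart
set_option linter.unusedSectionVars false
open Octonion
section ParaLinearMaps

variable {M M' M'' : Type*} [AddCommGroup M] [Module ℝ M] [OctBimodule M]
  [AddCommGroup M'] [Module ℝ M'] [OctBimodule M']
  [AddCommGroup M''] [Module ℝ M''] [OctBimodule M'']

/-- The second left associator `A_p(x, f) = f(px) - p f(x)`. -/
noncomputable def assocA (p : Octonion) (f : M →ₗ[ℝ] M') : M →ₗ[ℝ] M' :=
  f ∘ₗ OctBimodule.lsmul p - OctBimodule.lsmul p ∘ₗ f

/-- The second right associator `B_p(f, x) = f(x)p - f(xp)`. -/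
noncomputable def assocB (p : Octonion) (f : M →ₗ[ℝ] M') : M →ₗ[ℝ] M' :=
  OctBimodule.rsmul p ∘ₗ f - f ∘ₗ OctBimodule.rsmul p

theorem assocA_apply (p : Octonion) (f : M →ₗ[ℝ] M') (x : M) :
    assocA p f x = f (p •ₗ x) - p •ₗ f x := rfl

theorem assocB_apply (p : Octonion) (f : M →ₗ[ℝ] M') (x : M) :
    assocB p f x = f x •ᵣ p - f (x •ᵣ p) := rfl

/-- The left para-linear maps: the real linear maps `f` with `Re A_p(x, f) = 0` for all `p` and `x`. -/
noncomputable def leftPara (M M' : Type*) [AddCommGroup M] [Module ℝ M] [OctBimodule M]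
    [AddCommGroup M'] [Module ℝ M'] [OctBimodule M'] : Submodule ℝ (M →ₗ[ℝ] M') where
  carrier := {f | ∀ (p : Octonion) (x : M), reOp (assocA p f x) = 0}
  zero_mem' p x := by simp [assocA_apply]
  add_mem' {f g} hf hg p x := by
    have h1 := hf p x
    have h2 := hg p x
    simp only [assocA_apply, LinearMap.add_apply, map_add, map_sub] at *
    rw [add_sub_add_comm, h1, h2, add_zero]
  smul_mem' r f hf p x := by
    have h1 := hf p x
    simp only [assocA_apply, LinearMap.smul_apply, map_smul, map_sub] at *
    rw [← smul_sub, h1, smul_zero]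

/-- The right para-linear maps: the real linear maps `f` with `Re B_p(f, x) = 0` for all `p` and `x`. -/
noncomputable def rightPara (M M' : Type*) [AddCommGroup M] [Module ℝ M] [OctBimodule M]
    [AddCommGroup M'] [Module ℝ M'] [OctBimodule M'] : Submodule ℝ (M →ₗ[ℝ] M') where
  carrier := {f | ∀ (p : Octonion) (x : M), reOp (assocB p f x) = 0}
  zero_mem' p x := by simp [assocB_apply]
  add_mem' {f g} hf hg p x := by
    have h1 := hf p x
    have h2 := hg p x
    simp only [assocB_apply, LinearMap.add_apply, map_add, map_sub] at *
    rw [add_sub_add_comm, h1, h2, add_zero]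
  smul_mem' r f hf p x := by
    have h1 := hf p x
    simp only [assocB_apply, LinearMap.smul_apply, map_smul, map_sub] at *
    rw [← smul_sub, h1, smul_zero]

theorem re_left {f : M →ₗ[ℝ] M'} (hf : f ∈ leftPara M M') (p : Octonion) (x : M) :
    reOp (f (p •ₗ x)) = reOp (p •ₗ f x) := by
  have h := hf p x
  rwa [assocA_apply, map_sub, sub_eq_zero] at h

theorem re_right {f : M →ₗ[ℝ] M'} (hf : f ∈ rightPara M M') (p : Octonion) (x : M) :
    reOp (f (x •ᵣ p)) = reOp (f x •ᵣ p) := by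
  have h := hf p x
  rw [assocB_apply, map_sub, sub_eq_zero] at h
  exact h.symm

theorem re_assoc (p q : Octonion) (x : M) : reOp (p •ₗ (q •ₗ x)) = reOp ((p * q) •ₗ x) := by
  have h := reOp_lassoc p q x
  rw [lassoc, map_sub, sub_eq_zero] at h
  exact h.symm

theorem re_assoc_right (p q : Octonion) (x : M) :
    reOp ((x •ᵣ p) •ᵣ q) = reOp (x •ᵣ (p * q)) := by
  have h := reOp_lassoc p q x
  rw [lassoc, OctBimodule.assoc_right, map_sub, sub_eq_zero] at h
  exact h

theorem left_nucleus {f : M →ₗ[ℝ] M'} (hf : f ∈ leftPara M M') (p : Octonion) {x : M}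
    (hx : x ∈ nucleus M) : f (p •ₗ x) = p •ₗ f x := by
  refine sub_eq_zero.mp (eq_zero_of_reOp_lsmul fun q => ?_)
  rw [map_sub, map_sub, ← re_left hf, nucleus_mul hx, re_left hf, re_assoc, sub_self]

theorem right_nucleus {f : M →ₗ[ℝ] M'} (hf : f ∈ rightPara M M') (p : Octonion) {x : M}
    (hx : x ∈ nucleus M) : f (p •ₗ x) = f x •ᵣ p := by
  refine sub_eq_zero.mp (eq_zero_of_reOp_lsmul fun q => ?_)
  rw [reOp_comm, map_sub, map_sub, ← re_right hf, nucleus_mul_right hx, nucleus_central _ hx,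
    re_right hf, re_assoc_right, sub_self]

theorem mem_leftPara {f : M →ₗ[ℝ] M'}
    (h : ∀ (p : Octonion) (x : M), x ∈ nucleus M → f (p •ₗ x) = p •ₗ f x) : f ∈ leftPara M M' := by
  intro p x
  rw [assocA_apply, map_sub, ← eq_sum_reOp x]
  simp only [map_sum]
  rw [← Finset.sum_sub_distrib]
  refine Finset.sum_eq_zero fun i _ => ?_
  have hn := reOp_mem (conj (e i) •ₗ x)
  rw [nucleus_mul hn, h _ _ hn, h _ _ hn, re_assoc, sub_self]

theorem mem_rightPara {f : M →ₗ[ℝ] M'}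
    (h : ∀ (p : Octonion) (x : M), x ∈ nucleus M → f (p •ₗ x) = f x •ᵣ p) : f ∈ rightPara M M' := by
  intro p x
  rw [assocB_apply, map_sub, ← eq_sum_reOp x]
  simp only [map_sum]
  rw [← Finset.sum_sub_distrib]
  refine Finset.sum_eq_zero fun i _ => ?_
  have hn := reOp_mem (conj (e i) •ₗ x)
  rw [nucleus_mul_right hn, h _ _ hn, h _ _ hn, re_assoc_right, sub_self]

theorem left_ext {f g : leftPara M M'} (h : ∀ x ∈ nucleus M, f.1 x = g.1 x) : f = g := by
  refine Subtype.ext (LinearMap.ext fun x => ?_)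
  rw [← eq_sum_reOp x]
  simp only [map_sum]
  refine Finset.sum_congr rfl fun i _ => ?_
  have hn := reOp_mem (conj (e i) •ₗ x)
  rw [left_nucleus f.2 _ hn, left_nucleus g.2 _ hn, h _ hn]

theorem right_ext {f g : rightPara M M'} (h : ∀ x ∈ nucleus M, f.1 x = g.1 x) : f = g := by
  refine Subtype.ext (LinearMap.ext fun x => ?_)
  rw [← eq_sum_reOp x]
  simp only [map_sum]
  refine Finset.sum_congr rfl fun i _ => ?_
  have hn := reOp_mem (conj (e i) •ₗ x)
  rw [right_nucleus f.2 _ hn, right_nucleus g.2 _ hn, h _ hn]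

/-! ### The bimodule structure on para-linear maps -/

/-- `(r ⊙ f)(x) = f(xr) + A_r(x, f)`. -/
noncomputable def odotL (r : Octonion) (f : M →ₗ[ℝ] M') : M →ₗ[ℝ] M' :=
  f ∘ₗ OctBimodule.rsmul r + assocA r f

/-- `(f ⊙ r)(x) = f(x)r - A_r(x, f)`. -/
noncomputable def odotR (r : Octonion) (f : M →ₗ[ℝ] M') : M →ₗ[ℝ] M' :=
  OctBimodule.rsmul r ∘ₗ f - assocA r f

theorem odotL_apply (r : Octonion) (f : M →ₗ[ℝ] M') (x : M) :
    odotL r f x = f (x •ᵣ r) + (f (r •ₗ x) - r •ₗ f x) := rfl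

theorem odotR_apply (r : Octonion) (f : M →ₗ[ℝ] M') (x : M) :
    odotR r f x = f x •ᵣ r - (f (r •ₗ x) - r •ₗ f x) := rfl

theorem odotL_nucleus (r : Octonion) {f : M →ₗ[ℝ] M'} (hf : f ∈ leftPara M M') {x : M}
    (hx : x ∈ nucleus M) : odotL r f x = r •ₗ f x := by
  rw [odotL_apply, ← nucleus_central r hx, left_nucleus hf r hx]; abel

theorem odotR_nucleus (r : Octonion) {f : M →ₗ[ℝ] M'} (hf : f ∈ leftPara M M') {x : M}
    (hx : x ∈ nucleus M) : odotR r f x = f x •ᵣ r := by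
  rw [odotR_apply, left_nucleus hf r hx]; abel

theorem odotL_mem (r : Octonion) {f : M →ₗ[ℝ] M'} (hf : f ∈ leftPara M M') :
    odotL r f ∈ leftPara M M' := mem_leftPara fun p x hx => by
  rw [odotL_nucleus r hf hx, odotL_apply, nucleus_mul_right hx, nucleus_mul hx,
    left_nucleus hf _ hx, left_nucleus hf _ hx, left_nucleus hf _ hx, lsmul_lsmul_swap p r,
    map_add, LinearMap.add_apply]
  abel

theorem odotR_mem (r : Octonion) {f : M →ₗ[ℝ] M'} (hf : f ∈ leftPara M M') :
    odotR r f ∈ leftPara M M' := mem_leftPara fun p x hx => by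
  have h := OctBimodule.assoc_middle r p (f x)
  rw [odotR_nucleus r hf hx, odotR_apply, nucleus_mul hx,
    left_nucleus hf _ hx, left_nucleus hf _ hx, h]
  abel

theorem odotL_add_left (r s : Octonion) (f : M →ₗ[ℝ] M') :
    odotL (r + s) f = odotL r f + odotL s f := LinearMap.ext fun x => by
  simp only [odotL_apply, map_add, LinearMap.add_apply]; abel

theorem odotL_smul_left (c : ℝ) (r : Octonion) (f : M →ₗ[ℝ] M') :
    odotL (c • r) f = c • odotL r f := LinearMap.ext fun x => by
  simp only [odotL_apply, map_smul, LinearMap.smul_apply]; module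

theorem odotL_add_right (r : Octonion) (f g : M →ₗ[ℝ] M') :
    odotL r (f + g) = odotL r f + odotL r g := LinearMap.ext fun x => by
  simp only [odotL_apply, map_add, LinearMap.add_apply]; abel

theorem odotL_smul_right (c : ℝ) (r : Octonion) (f : M →ₗ[ℝ] M') :
    odotL r (c • f) = c • odotL r f := LinearMap.ext fun x => by
  simp only [odotL_apply, map_smul, LinearMap.smul_apply]; module

theorem odotR_add_left (r s : Octonion) (f : M →ₗ[ℝ] M') :
    odotR (r + s) f = odotR r f + odotR s f := LinearMap.ext fun x => by
  simp only [odotR_apply, map_add, LinearMap.add_apply]; abel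

theorem odotR_smul_left (c : ℝ) (r : Octonion) (f : M →ₗ[ℝ] M') :
    odotR (c • r) f = c • odotR r f := LinearMap.ext fun x => by
  simp only [odotR_apply, map_smul, LinearMap.smul_apply]; module

theorem odotR_add_right (r : Octonion) (f g : M →ₗ[ℝ] M') :
    odotR r (f + g) = odotR r f + odotR r g := LinearMap.ext fun x => by
  simp only [odotR_apply, map_add, LinearMap.add_apply]; abel

theorem odotR_smul_right (c : ℝ) (r : Octonion) (f : M →ₗ[ℝ] M') :
    odotR r (c • f) = c • odotR r f := LinearMap.ext fun x => by
  simp only [odotR_apply, map_smul, LinearMap.smul_apply]; module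

/-- The bimodule structure on `Hom_LO(M, M')`, by `(r ⊙ f)(x) = f(xr) + A_r(x, f)` and
`(f ⊙ r)(x) = f(x)r - A_r(x, f)`. -/
noncomputable instance leftParaBimodule : OctBimodule (leftPara M M') where
  lsmul := LinearMap.mk₂ ℝ (fun r f => ⟨odotL r f.1, odotL_mem r f.2⟩)
    (fun r s f => Subtype.ext (odotL_add_left r s f.1))
    (fun c r f => Subtype.ext (odotL_smul_left c r f.1))
    (fun r f g => Subtype.ext (odotL_add_right r f.1 g.1))
    (fun c r f => Subtype.ext (odotL_smul_right c r f.1))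
  rsmul := LinearMap.mk₂ ℝ (fun r f => ⟨odotR r f.1, odotR_mem r f.2⟩)
    (fun r s f => Subtype.ext (odotR_add_left r s f.1))
    (fun c r f => Subtype.ext (odotR_smul_left c r f.1))
    (fun r f g => Subtype.ext (odotR_add_right r f.1 g.1))
    (fun c r f => Subtype.ext (odotR_smul_right c r f.1))
  one_lsmul f := left_ext fun x hx => by
    simpa [OctBimodule.one_lsmul] using odotL_nucleus 1 f.2 hx
  one_rsmul f := left_ext fun x hx => by
    simpa [OctBimodule.one_rsmul] using odotR_nucleus 1 f.2 hx
  left_alt p q f := left_ext fun x hx => by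
    have := OctBimodule.left_alt p q (f.1 x)
    simpa [odotL_nucleus _ (odotL_mem _ f.2) hx, odotL_nucleus _ f.2 hx] using this
  assoc_right p q f := left_ext fun x hx => by
    have := OctBimodule.assoc_right p q (f.1 x)
    simpa [odotL_nucleus _ (odotL_mem _ f.2) hx, odotL_nucleus _ f.2 hx,
      odotR_nucleus _ (odotR_mem _ f.2) hx, odotR_nucleus _ f.2 hx] using this
  assoc_middle p q f := left_ext fun x hx => by
    have := OctBimodule.assoc_middle p q (f.1 x)
    simpa [odotL_nucleus _ (odotL_mem _ f.2) hx, odotL_nucleus _ f.2 hx,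
      odotR_nucleus _ (odotL_mem _ f.2) hx, odotL_nucleus _ (odotR_mem _ f.2) hx,
      odotR_nucleus _ f.2 hx] using this

theorem lsmul_val (r : Octonion) (f : leftPara M M') : (r •ₗ f).1 = odotL r f.1 := rfl
theorem rsmul_val (r : Octonion) (f : leftPara M M') : (f •ᵣ r).1 = odotR r f.1 := rfl

theorem lsmul_nucleus (r : Octonion) (f : leftPara M M') {x : M} (hx : x ∈ nucleus M) :
    (r •ₗ f).1 x = r •ₗ f.1 x := odotL_nucleus r f.2 hx

theorem rsmul_nucleus (r : Octonion) (f : leftPara M M') {x : M} (hx : x ∈ nucleus M) :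
    (f •ᵣ r).1 x = f.1 x •ᵣ r := odotR_nucleus r f.2 hx

/-- An associative element of `Hom_LO(M, M')` maps `Re M` to `Re M'`. -/
theorem apply_mem_nucleus {f : leftPara M M'} (hf : f ∈ nucleus (leftPara M M')) {x : M}
    (hx : x ∈ nucleus M) : f.1 x ∈ nucleus M' := by
  intro p q
  have h := congrArg (fun g : leftPara M M' => g.1 x) (hf p q)
  simpa [lassoc, lsmul_nucleus _ _ hx] using h

/-- A left para-linear map that maps `Re M` to `Re M'` is left `𝕆`-linear. -/
theorem lsmul_of_nucleus {f : M →ₗ[ℝ] M'} (hf : f ∈ leftPara M M')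
    (h : ∀ x ∈ nucleus M, f x ∈ nucleus M') (p : Octonion) (x : M) : f (p •ₗ x) = p •ₗ f x := by
  rw [← eq_sum_reOp x]
  simp only [map_sum]
  refine Finset.sum_congr rfl fun i _ => ?_
  have hn := reOp_mem (conj (e i) •ₗ x)
  rw [nucleus_mul hn, left_nucleus hf _ hn, left_nucleus hf _ hn, nucleus_mul (h _ hn)]

theorem reOp_of_nucleus {f : M →ₗ[ℝ] M'} (hf : f ∈ leftPara M M')
    (h : ∀ x ∈ nucleus M, f x ∈ nucleus M') (x : M) : reOp (f x) = f (reOp x) := by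
  rw [← eq_sum_reOp x]
  simp only [map_sum]
  refine Finset.sum_congr rfl fun i _ => ?_
  have hn := reOp_mem (conj (e i) •ₗ x)
  rw [left_nucleus hf _ hn, reOp_lsmul hn, reOp_lsmul (h _ hn), map_smul]

/-! ### Regular composition -/

/-- The left regular composition `f(g(x)) - ∑ⱼ eⱼ Re f(A_{eⱼ}(x, g))`, with `j = 1, …, 7`. -/
noncomputable def regComp (f : M' →ₗ[ℝ] M'') (g : M →ₗ[ℝ] M') : M →ₗ[ℝ] M'' :=
  f ∘ₗ g - ∑ j : Fin 7, OctBimodule.lsmul (e j.succ) ∘ₗ reOp ∘ₗ f ∘ₗ assocA (e j.succ) g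

/-- The right regular composition `f(g(x)) + ∑ⱼ (Re f(B_{eⱼ}(g, x))) eⱼ`, with `j = 1, …, 7`. -/
noncomputable def regCompR (f : M' →ₗ[ℝ] M'') (g : M →ₗ[ℝ] M') : M →ₗ[ℝ] M'' :=
  f ∘ₗ g + ∑ j : Fin 7, OctBimodule.rsmul (e j.succ) ∘ₗ reOp ∘ₗ f ∘ₗ assocB (e j.succ) g

theorem regComp_apply (f : M' →ₗ[ℝ] M'') (g : M →ₗ[ℝ] M') (x : M) :
    regComp f g x = f (g x) - ∑ j : Fin 7, e j.succ •ₗ reOp (f (assocA (e j.succ) g x)) := by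
  simp [regComp]

theorem regCompR_apply (f : M' →ₗ[ℝ] M'') (g : M →ₗ[ℝ] M') (x : M) :
    regCompR f g x = f (g x) + ∑ j : Fin 7, reOp (f (assocB (e j.succ) g x)) •ᵣ e j.succ := by
  simp [regCompR]

theorem regComp_nucleus (f : M' →ₗ[ℝ] M'') {g : M →ₗ[ℝ] M'} (hg : g ∈ leftPara M M') {x : M}
    (hx : x ∈ nucleus M) : regComp f g x = f (g x) := by
  simp [regComp_apply, assocA_apply, left_nucleus hg _ hx]

theorem regCompR_nucleus (f : M' →ₗ[ℝ] M'') {g : M →ₗ[ℝ] M'} (hg : g ∈ rightPara M M') {x : M}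
    (hx : x ∈ nucleus M) : regCompR f g x = f (g x) := by
  simp [regCompR_apply, assocB_apply, ← nucleus_central _ hx, right_nucleus hg _ hx]

/-- The second associator of a left para-linear map. -/
theorem assocA_eq {f : M →ₗ[ℝ] M'} (hf : f ∈ leftPara M M') (p : Octonion) (x : M) :
    f (p •ₗ x) - p •ₗ f x = ∑ j : Fin 7, e j.succ •ₗ reOp (f (lassoc (e j.succ) p x)) := by
  rw [← eq_sum_reOp (f (p •ₗ x) - p •ₗ f x), Fin.sum_univ_succ]
  have h : ∀ q : Octonion, reOp (q •ₗ (f (p •ₗ x) - p •ₗ f x)) = -reOp (f (lassoc q p x)) := by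
    intro q
    rw [map_sub, map_sub, ← re_left hf, re_assoc, ← re_left hf, lassoc, map_sub, map_sub]
    abel
  simp only [h, conj_e_zero, conj_e_succ]
  simp [lassoc, ← one_eq, OctBimodule.one_lsmul, Finset.sum_add_distrib]
  abel

theorem assocB_eq {f : M →ₗ[ℝ] M'} (hf : f ∈ rightPara M M') (p : Octonion) (x : M) :
    f x •ᵣ p - f (x •ᵣ p) =
      ∑ j : Fin 7, reOp (f ((x •ᵣ p) •ᵣ e j.succ - x •ᵣ (p * e j.succ))) •ᵣ e j.succ := by
  rw [← eq_sum_reOp (f x •ᵣ p - f (x •ᵣ p)), Fin.sum_univ_succ]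
  have h : ∀ q : Octonion, reOp (q •ₗ (f x •ᵣ p - f (x •ᵣ p))) =
      -reOp (f ((x •ᵣ p) •ᵣ q - x •ᵣ (p * q))) := by
    intro q
    rw [reOp_comm, map_sub, map_sub, ← re_right hf, re_assoc_right, ← re_right hf, map_sub, map_sub]
    abel
  simp only [h, conj_e_zero, conj_e_succ, ← nucleus_central _ (reOp_mem _)]
  simp [← one_eq, OctBimodule.one_rsmul, OctBimodule.one_lsmul, Finset.sum_add_distrib]
  abel

theorem regComp_mem {f : M' →ₗ[ℝ] M''} (hf : f ∈ leftPara M' M'') {g : M →ₗ[ℝ] M'}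
    (hg : g ∈ leftPara M M') : regComp f g ∈ leftPara M M'' := mem_leftPara fun p x hx => by
  have h : ∀ j : Fin 7, assocA (e j.succ) g (p •ₗ x) = lassoc (e j.succ) p (g x) := fun j => by
    rw [assocA_apply, nucleus_mul hx, left_nucleus hg _ hx, left_nucleus hg _ hx, lassoc]
  rw [regComp_nucleus f hg hx, regComp_apply, left_nucleus hg _ hx]
  simp only [h]
  rw [← assocA_eq hf]
  abel

theorem regCompR_mem {f : M' →ₗ[ℝ] M''} (hf : f ∈ rightPara M' M'') {g : M →ₗ[ℝ] M'}
    (hg : g ∈ rightPara M M') : regCompR f g ∈ rightPara M M'' := mem_rightPara fun p x hx => by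
  have h : ∀ j : Fin 7, assocB (e j.succ) g (p •ₗ x) =
      (g x •ᵣ p) •ᵣ e j.succ - g x •ᵣ (p * e j.succ) := fun j => by
    rw [assocB_apply, nucleus_mul_right hx, right_nucleus hg _ hx, right_nucleus hg _ hx]
  rw [regCompR_nucleus f hg hx, regCompR_apply, right_nucleus hg _ hx]
  simp only [h]
  rw [← assocB_eq hf]
  abel

theorem id_mem_left : LinearMap.id ∈ leftPara M M := mem_leftPara fun _ _ _ => rfl

theorem id_mem_right : LinearMap.id ∈ rightPara M M := mem_rightPara fun p _ hx =>
  nucleus_central p hx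

theorem rsmul_mem_left (p : Octonion) : OctBimodule.rsmul p ∈ leftPara M M :=
  mem_leftPara fun q x hx => by
    rw [nucleus_mul_right hx, ← nucleus_central p hx, nucleus_mul hx]

end ParaLinearMaps
open Octonion CategoryTheory Opposite

/-! ### Non-associative categories, functors and weak functors -/

/-- A non-associative category: morphisms, composition and identities with the unit laws only. -/
class NonassocCategory.{v, u} (C : Type u) extends CategoryStruct.{v} C where
  id_comp' : ∀ {X Y : C} (f : X ⟶ Y), 𝟙 X ≫ f = f
  comp_id' : ∀ {X Y : C} (f : X ⟶ Y), f ≫ 𝟙 Y = f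

/-- A morphism is associative if every composite of three morphisms that contains it is associative. -/
def IsAssociativeMor.{v, u} {C : Type u} [NonassocCategory.{v, u} C] {X Y : C} (f : X ⟶ Y) : Prop :=
  (∀ (W V : C) (h : W ⟶ V) (g : V ⟶ X), h ≫ (g ≫ f) = (h ≫ g) ≫ f) ∧
  (∀ (W V : C) (g : W ⟶ X) (h : Y ⟶ V), g ≫ (f ≫ h) = (g ≫ f) ≫ h) ∧
  (∀ (V W : C) (g : Y ⟶ V) (h : V ⟶ W), f ≫ (g ≫ h) = (f ≫ g) ≫ h)

/-- Covariant functors between non-associative categories. -/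
structure NonassocFunctor.{v₁, v₂, u₁, u₂} (C : Type u₁) [NonassocCategory.{v₁, u₁} C]
    (D : Type u₂) [NonassocCategory.{v₂, u₂} D] where
  obj : C → D
  map : ∀ {X Y : C}, (X ⟶ Y) → (obj X ⟶ obj Y)
  map_id : ∀ X : C, map (𝟙 X) = 𝟙 (obj X)
  map_comp : ∀ {X Y Z : C} (f : X ⟶ Y) (g : Y ⟶ Z), map (f ≫ g) = map f ≫ map g

/-- Contravariant functors between non-associative categories. -/
structure NonassocContraFunctor.{v₁, v₂, u₁, u₂} (C : Type u₁) [NonassocCategory.{v₁, u₁} C]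
    (D : Type u₂) [NonassocCategory.{v₂, u₂} D] where
  obj : C → D
  map : ∀ {X Y : C}, (X ⟶ Y) → (obj Y ⟶ obj X)
  map_id : ∀ X : C, map (𝟙 X) = 𝟙 (obj X)
  map_comp : ∀ {X Y Z : C} (f : X ⟶ Y) (g : Y ⟶ Z), map (f ≫ g) = map g ≫ map f

/-- Covariant weak functors from a non-associative category to a category. -/
structure WeakFunctor.{v₁, v₂, u₁, u₂} (C : Type u₁) [NonassocCategory.{v₁, u₁} C]
    (D : Type u₂) [Category.{v₂, u₂} D] where
  obj : C → D
  map : ∀ {X Y : C}, (X ⟶ Y) → (obj X ⟶ obj Y)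
  map_id : ∀ X : C, map (𝟙 X) = 𝟙 (obj X)
  map_comp : ∀ {X Y Z : C} (f : X ⟶ Y) (g : Y ⟶ Z), IsAssociativeMor f ∨ IsAssociativeMor g →
    map (f ≫ g) = map f ≫ map g

/-! ### Natural lift and natural extension transformations

Here `ι₁ : C → C'` and `ι₂ : D → D'` are weak functors to categories `C'` and `D'`. -/

section Natural

universe v₁ v₂ v₃ v₄ u₁ u₂ u₃ u₄

variable {C : Type u₁} [NonassocCategory.{v₁, u₁} C] {D : Type u₂} [NonassocCategory.{v₂, u₂} D]
  {C' : Type u₃} [Category.{v₃, u₃} C'] {D' : Type u₄} [Category.{v₄, u₄} D']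
  (ι₁ : WeakFunctor C C') (ι₂ : WeakFunctor D D')

/-- `τ_X : S(ι₁ X) ⟶ ι₂(T X)` is a natural lift transformation `S → T` of covariant functors. -/
def IsNatLift (S : C' ⥤ D') (T : NonassocFunctor C D)
    (τ : ∀ X : C, S.obj (ι₁.obj X) ⟶ ι₂.obj (T.obj X)) : Prop :=
  ∀ ⦃X Y : C⦄ (f : X ⟶ Y), τ X ≫ ι₂.map (T.map f) = S.map (ι₁.map f) ≫ τ Y

/-- `η_X : ι₂(T X) ⟶ S(ι₁ X)` is a natural extension transformation `T → S` of covariant functors. -/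
def IsNatExt (S : C' ⥤ D') (T : NonassocFunctor C D)
    (η : ∀ X : C, ι₂.obj (T.obj X) ⟶ S.obj (ι₁.obj X)) : Prop :=
  ∀ ⦃X Y : C⦄ (f : X ⟶ Y), η X ≫ S.map (ι₁.map f) = ι₂.map (T.map f) ≫ η Y

/-- A natural lift isomorphism of covariant functors. -/
def IsNatLiftIso (S : C' ⥤ D') (T : NonassocFunctor C D)
    (τ : ∀ X : C, S.obj (ι₁.obj X) ⟶ ι₂.obj (T.obj X)) : Prop :=
  IsNatLift ι₁ ι₂ S T τ ∧ ∀ X, IsIso (τ X)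

/-- A natural extension isomorphism of covariant functors. -/
def IsNatExtIso (S : C' ⥤ D') (T : NonassocFunctor C D)
    (η : ∀ X : C, ι₂.obj (T.obj X) ⟶ S.obj (ι₁.obj X)) : Prop :=
  IsNatExt ι₁ ι₂ S T η ∧ ∀ X, IsIso (η X)

/-- `S` is a natural associated functor of the covariant functor `T`. -/
def IsNatAssociated (S : C' ⥤ D') (T : NonassocFunctor C D) : Prop :=
  (∃ τ, IsNatLiftIso ι₁ ι₂ S T τ) ∨ ∃ η, IsNatExtIso ι₁ ι₂ S T η

/-- `τ_X : S(ι₁ X) ⟶ ι₂(T X)` is a natural lift transformation of contravariant functors. -/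
def IsContraNatLift (S : C'ᵒᵖ ⥤ D') (T : NonassocContraFunctor C D)
    (τ : ∀ X : C, S.obj (op (ι₁.obj X)) ⟶ ι₂.obj (T.obj X)) : Prop :=
  ∀ ⦃Y X : C⦄ (f : Y ⟶ X), τ X ≫ ι₂.map (T.map f) = S.map (ι₁.map f).op ≫ τ Y

/-- `η_X : ι₂(T X) ⟶ S(ι₁ X)` is a natural extension transformation of contravariant functors. -/
def IsContraNatExt (S : C'ᵒᵖ ⥤ D') (T : NonassocContraFunctor C D)
    (η : ∀ X : C, ι₂.obj (T.obj X) ⟶ S.obj (op (ι₁.obj X))) : Prop :=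
  ∀ ⦃Y X : C⦄ (f : Y ⟶ X), η X ≫ S.map (ι₁.map f).op = ι₂.map (T.map f) ≫ η Y

/-- A natural lift isomorphism of contravariant functors. -/
def IsContraNatLiftIso (S : C'ᵒᵖ ⥤ D') (T : NonassocContraFunctor C D)
    (τ : ∀ X : C, S.obj (op (ι₁.obj X)) ⟶ ι₂.obj (T.obj X)) : Prop :=
  IsContraNatLift ι₁ ι₂ S T τ ∧ ∀ X, IsIso (τ X)

/-- A natural extension isomorphism of contravariant functors. -/
def IsContraNatExtIso (S : C'ᵒᵖ ⥤ D') (T : NonassocContraFunctor C D)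
    (η : ∀ X : C, ι₂.obj (T.obj X) ⟶ S.obj (op (ι₁.obj X))) : Prop :=
  IsContraNatExt ι₁ ι₂ S T η ∧ ∀ X, IsIso (η X)

/-- `S` is a natural associated functor of the contravariant functor `T`. -/
def IsContraNatAssociated (S : C'ᵒᵖ ⥤ D') (T : NonassocContraFunctor C D) : Prop :=
  (∃ τ, IsContraNatLiftIso ι₁ ι₂ S T τ) ∨ ∃ η, IsContraNatExtIso ι₁ ι₂ S T η

end Natural

/-! ### The categories of `𝕆`-bimodules -/

section Comp

variable {M M' M'' : Type*} [AddCommGroup M] [Module ℝ M] [OctBimodule M]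
  [AddCommGroup M'] [Module ℝ M'] [OctBimodule M']
  [AddCommGroup M''] [Module ℝ M''] [OctBimodule M'']

/-- The left regular composition as a map of left para-linear maps. -/
noncomputable def leftComp (g : leftPara M' M'') (f : leftPara M M') : leftPara M M'' :=
  ⟨regComp g.1 f.1, regComp_mem g.2 f.2⟩

/-- The right regular composition as a map of right para-linear maps. -/
noncomputable def rightComp (g : rightPara M' M'') (f : rightPara M M') : rightPara M M'' :=
  ⟨regCompR g.1 f.1, regCompR_mem g.2 f.2⟩

theorem leftComp_val (g : leftPara M' M'') (f : leftPara M M') :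
    (leftComp g f).1 = regComp g.1 f.1 := rfl

theorem rightComp_val (g : rightPara M' M'') (f : rightPara M M') :
    (rightComp g f).1 = regCompR g.1 f.1 := rfl

end Comp

/-- Bundled `𝕆`-bimodules. -/
structure BimodCat.{u} : Type (u + 1) where
  carrier : Type u
  [addCommGroup : AddCommGroup carrier]
  [module : Module ℝ carrier]
  [bimodule : OctBimodule carrier]

attribute [instance] BimodCat.addCommGroup BimodCat.module BimodCat.bimodule

/-- The non-associative category `LO`: `𝕆`-bimodules, left para-linear maps and left regular
compositions. -/
structure LO.{u} : Type (u + 1) where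
  mod : BimodCat.{u}

/-- The non-associative category `RO`: `𝕆`-bimodules, right para-linear maps and right regular
compositions. -/
structure RO.{u} : Type (u + 1) where
  mod : BimodCat.{u}

/-- The category `𝕆-Mod_ℝ`: `𝕆`-bimodules, real linear maps and compositions of maps. -/
structure OModR.{u} : Type (u + 1) where
  mod : BimodCat.{u}

universe u

noncomputable instance : NonassocCategory.{u, u + 1} LO.{u} where
  Hom X Y := leftPara X.mod.carrier Y.mod.carrier
  id _ := ⟨LinearMap.id, id_mem_left⟩
  comp f g := leftComp g f
  id_comp' _ := left_ext fun _ hx => regComp_nucleus _ id_mem_left hx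
  comp_id' f := left_ext fun _ hx => regComp_nucleus _ f.2 hx

noncomputable instance : NonassocCategory.{u, u + 1} RO.{u} where
  Hom X Y := rightPara X.mod.carrier Y.mod.carrier
  id _ := ⟨LinearMap.id, id_mem_right⟩
  comp f g := rightComp g f
  id_comp' _ := right_ext fun _ hx => regCompR_nucleus _ id_mem_right hx
  comp_id' f := right_ext fun _ hx => regCompR_nucleus _ f.2 hx

noncomputable instance : Category.{u, u + 1} OModR.{u} where
  Hom X Y := X.mod.carrier →ₗ[ℝ] Y.mod.carrier
  id X := LinearMap.id
  comp f g := g ∘ₗ f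
open Octonion CategoryTheory Opposite

attribute [local irreducible] regComp regCompR reOp

section Nucleus

variable {M M' : Type*} [AddCommGroup M] [Module ℝ M] [OctBimodule M]
  [AddCommGroup M'] [Module ℝ M'] [OctBimodule M']

theorem rsmul_of_nucleus_left {f : M →ₗ[ℝ] M'} (hf : f ∈ leftPara M M')
    (h : ∀ x ∈ nucleus M, f x ∈ nucleus M') (p : Octonion) (x : M) : f (x •ᵣ p) = f x •ᵣ p := by
  rw [← eq_sum_reOp x]
  simp only [map_sum]
  refine Finset.sum_congr rfl fun i _ => ?_
  have hn := reOp_mem (conj (e i) •ₗ x)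
  rw [nucleus_mul_right hn, left_nucleus hf _ hn, left_nucleus hf _ hn, nucleus_mul_right (h _ hn)]

theorem rsmul_of_nucleus {f : M →ₗ[ℝ] M'} (hf : f ∈ rightPara M M')
    (h : ∀ x ∈ nucleus M, f x ∈ nucleus M') (p : Octonion) (x : M) : f (x •ᵣ p) = f x •ᵣ p := by
  rw [← eq_sum_reOp x]
  simp only [map_sum]
  refine Finset.sum_congr rfl fun i _ => ?_
  have hn := reOp_mem (conj (e i) •ₗ x)
  rw [nucleus_mul_right hn, right_nucleus hf _ hn, right_nucleus hf _ hn,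
    ← nucleus_central _ (h _ hn), ← nucleus_central _ (h _ hn), nucleus_mul_right (h _ hn)]

theorem reOp_of_nucleus_right {f : M →ₗ[ℝ] M'} (hf : f ∈ rightPara M M')
    (h : ∀ x ∈ nucleus M, f x ∈ nucleus M') (x : M) : reOp (f x) = f (reOp x) := by
  rw [← eq_sum_reOp x]
  simp only [map_sum]
  refine Finset.sum_congr rfl fun i _ => ?_
  have hn := reOp_mem (conj (e i) •ₗ x)
  rw [right_nucleus hf _ hn, reOp_lsmul hn, ← nucleus_central _ (h _ hn), reOp_lsmul (h _ hn),
    map_smul]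

theorem lsmul_mem_right (p : Octonion) : OctBimodule.lsmul p ∈ rightPara M M :=
  mem_rightPara fun q x hx => by
    rw [nucleus_mul hx, nucleus_mul_right hx]

end Nucleus

/-! ### The weak functors to `𝕆-Mod_ℝ` -/

theorem LO.val_comp {X Y Z : LO.{u}} (f : X ⟶ Y) (g : Y ⟶ Z) : (f ≫ g).1 = regComp g.1 f.1 := rfl

theorem RO.val_comp {X Y Z : RO.{u}} (f : X ⟶ Y) (g : Y ⟶ Z) : (f ≫ g).1 = regCompR g.1 f.1 := rfl

/-- Associative morphisms of `LO` preserve real parts. -/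
theorem LO.apply_mem {X Y : LO.{u}} {f : X ⟶ Y} (hf : IsAssociativeMor f) {x : X.mod.carrier}
    (hx : x ∈ nucleus X.mod.carrier) : f.1 x ∈ nucleus Y.mod.carrier := by
  intro p q
  have key : ∀ g h : X ⟶ X, regComp (regComp f.1 g.1) h.1 = regComp f.1 (regComp g.1 h.1) :=
    fun g h => congrArg Subtype.val (hf.1 X X h g)
  have h := LinearMap.congr_fun (key ⟨_, rsmul_mem_left q⟩ ⟨_, rsmul_mem_left p⟩) x
  rw [regComp_nucleus _ (rsmul_mem_left p) hx,
    regComp_nucleus _ (regComp_mem (rsmul_mem_left q) (rsmul_mem_left p)) hx,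
    regComp_nucleus _ (rsmul_mem_left p) hx, ← nucleus_central p hx,
    left_nucleus (regComp_mem f.2 (rsmul_mem_left q)) p hx,
    regComp_nucleus _ (rsmul_mem_left q) hx, ← nucleus_central q hx, nucleus_mul_right hx,
    left_nucleus f.2 _ hx, left_nucleus f.2 _ hx] at h
  rw [lassoc, h, sub_self]

/-- Associative morphisms of `RO` preserve real parts. -/
theorem RO.apply_mem {X Y : RO.{u}} {f : X ⟶ Y} (hf : IsAssociativeMor f) {x : X.mod.carrier}
    (hx : x ∈ nucleus X.mod.carrier) : f.1 x ∈ nucleus Y.mod.carrier := by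
  intro q p
  have key : ∀ g h : X ⟶ X, regCompR (regCompR f.1 g.1) h.1 = regCompR f.1 (regCompR g.1 h.1) :=
    fun g h => congrArg Subtype.val (hf.1 X X h g)
  have h := LinearMap.congr_fun (key ⟨_, lsmul_mem_right q⟩ ⟨_, lsmul_mem_right p⟩) x
  rw [regCompR_nucleus _ (lsmul_mem_right p) hx,
    regCompR_nucleus _ (regCompR_mem (lsmul_mem_right q) (lsmul_mem_right p)) hx,
    regCompR_nucleus _ (lsmul_mem_right p) hx,
    right_nucleus (regCompR_mem f.2 (lsmul_mem_right q)) p hx,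
    regCompR_nucleus _ (lsmul_mem_right q) hx, nucleus_mul hx,
    right_nucleus f.2 _ hx, right_nucleus f.2 _ hx] at h
  rw [lassoc, OctBimodule.assoc_right, h, sub_self]

/-- If `f` or `g` is associative, then the left regular composition is the composition of maps. -/
theorem LO.comp_val {X Y Z : LO.{u}} (f : X ⟶ Y) (g : Y ⟶ Z)
    (h : IsAssociativeMor f ∨ IsAssociativeMor g) : (f ≫ g).1 = g.1 ∘ₗ f.1 := by
  refine LinearMap.ext fun x => ?_
  rw [LO.val_comp, LinearMap.comp_apply, regComp_apply, sub_eq_self]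
  refine Finset.sum_eq_zero fun j _ => ?_
  rcases h with h | h
  · have := lsmul_of_nucleus f.2 (fun x hx => LO.apply_mem h hx)
    simp [assocA_apply, this]
  · rw [reOp_of_nucleus g.2 (fun x hx => LO.apply_mem h hx), f.2, map_zero, map_zero]

/-- If `f` or `g` is associative, then the right regular composition is the composition of maps. -/
theorem RO.comp_val {X Y Z : RO.{u}} (f : X ⟶ Y) (g : Y ⟶ Z)
    (h : IsAssociativeMor f ∨ IsAssociativeMor g) : (f ≫ g).1 = g.1 ∘ₗ f.1 := by
  refine LinearMap.ext fun x => ?_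
  rw [RO.val_comp, LinearMap.comp_apply, regCompR_apply, add_eq_left]
  refine Finset.sum_eq_zero fun j _ => ?_
  rcases h with h | h
  · have := rsmul_of_nucleus f.2 (fun x hx => RO.apply_mem h hx)
    simp [assocB_apply, this]
  · rw [reOp_of_nucleus_right g.2 (fun x hx => RO.apply_mem h hx), f.2, map_zero, map_zero]

/-- The weak functor `LO → 𝕆-Mod_ℝ`, the identity on objects and on maps. -/
noncomputable def ιLO : WeakFunctor LO.{u} OModR.{u} where
  obj X := ⟨X.mod⟩
  map f := f.1
  map_id _ := rfl
  map_comp f g h := LO.comp_val f g h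

/-- The weak functor `RO → 𝕆-Mod_ℝ`, the identity on objects and on maps. -/
noncomputable def ιRO : WeakFunctor RO.{u} OModR.{u} where
  obj X := ⟨X.mod⟩
  map f := f.1
  map_id _ := rfl
  map_comp f g h := RO.comp_val f g h

/-! ### The Hom functors on `LO` -/

section RegCompLinear

variable {M M' M'' : Type*} [AddCommGroup M] [Module ℝ M] [OctBimodule M]
  [AddCommGroup M'] [Module ℝ M'] [OctBimodule M']
  [AddCommGroup M''] [Module ℝ M''] [OctBimodule M'']

/-- `g ↦ f ⊚ g`. -/
noncomputable def postComp (M : Type*) [AddCommGroup M] [Module ℝ M] [OctBimodule M]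
    (f : leftPara M' M'') : leftPara M M' →ₗ[ℝ] leftPara M M'' where
  toFun g := leftComp f g
  map_add' g h := left_ext fun x hx => by
    simp [leftComp_val, regComp_nucleus _ (add_mem g.2 h.2) hx, regComp_nucleus _ g.2 hx,
      regComp_nucleus _ h.2 hx]
  map_smul' r g := left_ext fun x hx => by
    simp [leftComp_val, regComp_nucleus _ (Submodule.smul_mem _ r g.2) hx, regComp_nucleus _ g.2 hx]

/-- `g ↦ g ⊚ f`. -/
noncomputable def preComp (f : leftPara M M') (M'' : Type*) [AddCommGroup M''] [Module ℝ M'']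
    [OctBimodule M''] : leftPara M' M'' →ₗ[ℝ] leftPara M M'' where
  toFun g := leftComp g f
  map_add' g h := left_ext fun x hx => by simp [leftComp_val, regComp_nucleus _ f.2 hx]
  map_smul' r g := left_ext fun x hx => by simp [leftComp_val, regComp_nucleus _ f.2 hx]

theorem postComp_nucleus (f : leftPara M' M'') (g : leftPara M M') {x : M} (hx : x ∈ nucleus M) :
    (postComp M f g).1 x = f.1 (g.1 x) := regComp_nucleus _ g.2 hx

theorem preComp_nucleus (f : leftPara M M') (g : leftPara M' M'') {x : M} (hx : x ∈ nucleus M) :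
    (preComp f M'' g).1 x = g.1 (f.1 x) := regComp_nucleus _ f.2 hx

theorem postComp_mem (f : leftPara M' M'') :
    postComp M f ∈ leftPara (leftPara M M') (leftPara M M'') :=
  mem_leftPara fun p g hg => left_ext fun x hx => by
    rw [postComp_nucleus _ _ hx, lsmul_nucleus _ _ hx, lsmul_nucleus _ _ hx,
      postComp_nucleus _ _ hx, left_nucleus f.2 _ (apply_mem_nucleus hg hx)]

theorem preComp_mem (f : leftPara M M') :
    preComp f M'' ∈ rightPara (leftPara M' M'') (leftPara M M'') :=
  mem_rightPara fun p g hg => left_ext fun x hx => by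
    have h : ∀ x ∈ nucleus M', g.1 x ∈ nucleus M'' := fun x hx => apply_mem_nucleus hg hx
    rw [preComp_nucleus _ _ hx, rsmul_nucleus _ _ hx, preComp_nucleus _ _ hx, lsmul_val,
      odotL_apply, lsmul_of_nucleus g.2 h, sub_self, add_zero, rsmul_of_nucleus_left g.2 h]

/-- `g ↦ f ⊚ g` as a left para-linear map. -/
noncomputable def postCompMor (M : Type*) [AddCommGroup M] [Module ℝ M] [OctBimodule M]
    (f : leftPara M' M'') : leftPara (leftPara M M') (leftPara M M'') :=
  ⟨postComp M f, postComp_mem f⟩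

/-- `g ↦ g ⊚ f` as a right para-linear map. -/
noncomputable def preCompMor (f : leftPara M M') (M'' : Type*) [AddCommGroup M''] [Module ℝ M'']
    [OctBimodule M''] : rightPara (leftPara M' M'') (leftPara M M'') :=
  ⟨preComp f M'', preComp_mem f⟩

theorem postCompMor_id : postCompMor M (⟨LinearMap.id, id_mem_left⟩ : leftPara M' M') =
    ⟨LinearMap.id, id_mem_left⟩ :=
  left_ext fun g _ => left_ext fun _ hx => postComp_nucleus _ g hx

theorem preCompMor_id : preCompMor (⟨LinearMap.id, id_mem_left⟩ : leftPara M M) M' =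
    ⟨LinearMap.id, id_mem_right⟩ :=
  right_ext fun g _ => left_ext fun _ hx => preComp_nucleus _ g hx

theorem postCompMor_val (M : Type*) [AddCommGroup M] [Module ℝ M] [OctBimodule M]
    (f : leftPara M' M'') : (postCompMor M f).1 = postComp M f := rfl

theorem postCompMor_nucleus {N : Type*} [AddCommGroup N] [Module ℝ N] [OctBimodule N]
    (f : leftPara M M') (g : leftPara N M) {x : N} (hx : x ∈ nucleus N) :
    ((postCompMor N f).1 g).1 x = f.1 (g.1 x) := by
  rw [postCompMor_val, postComp_nucleus f g hx]

theorem preCompMor_nucleus {N : Type*} [AddCommGroup N] [Module ℝ N] [OctBimodule N]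
    (f : leftPara M M') (g : leftPara M' N) {x : M} (hx : x ∈ nucleus M) :
    ((preCompMor f N).1 g).1 x = g.1 (f.1 x) := preComp_nucleus f g hx

theorem leftComp_nucleus (g : leftPara M' M'') (f : leftPara M M') {x : M} (hx : x ∈ nucleus M) :
    (leftComp g f).1 x = g.1 (f.1 x) := regComp_nucleus g.1 f.2 hx

theorem rightComp_nucleus (g : rightPara M' M'') (f : rightPara M M') {x : M}
    (hx : x ∈ nucleus M) : (rightComp g f).1 x = g.1 (f.1 x) := regCompR_nucleus g.1 f.2 hx

theorem leftComp_of_nucleus {g : leftPara M' M''} (hg : g ∈ nucleus (leftPara M' M''))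
    (f : leftPara M M') (x : M) : (leftComp g f).1 x = g.1 (f.1 x) := by
  have hg' : ∀ x ∈ nucleus M', g.1 x ∈ nucleus M'' := fun x hx => apply_mem_nucleus hg hx
  rw [leftComp_val, regComp_apply, sub_eq_self]
  refine Finset.sum_eq_zero fun j _ => ?_
  rw [reOp_of_nucleus g.2 hg', f.2, map_zero, map_zero]

theorem postCompMor_comp {N : Type*} [AddCommGroup N] [Module ℝ N] [OctBimodule N]
    (f : leftPara M M') (f' : leftPara M' M'') :
    postCompMor N (leftComp f' f) = leftComp (postCompMor N f') (postCompMor N f) := by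
  refine left_ext fun g hg => ?_
  have h := leftComp_nucleus (postCompMor N f') (postCompMor N f) hg
  refine Eq.trans ?_ h.symm
  refine left_ext fun x hx => ?_
  have h1 := postCompMor_nucleus (leftComp f' f) g hx
  have h2 := postCompMor_nucleus f' ((postCompMor N f).1 g) hx
  have h3 := postCompMor_nucleus f g hx
  have h4 := leftComp_nucleus f' f (apply_mem_nucleus hg hx)
  rw [h1, h2, h3, h4]

theorem preCompMor_comp {N : Type*} [AddCommGroup N] [Module ℝ N] [OctBimodule N]
    (f : leftPara M M') (f' : leftPara M' M'') :
    preCompMor (leftComp f' f) N = rightComp (preCompMor f N) (preCompMor f' N) := by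
  refine right_ext fun g hg => ?_
  have h := rightComp_nucleus (preCompMor f N) (preCompMor f' N) hg
  refine Eq.trans ?_ h.symm
  refine left_ext fun x hx => ?_
  have h1 := preCompMor_nucleus (leftComp f' f) g hx
  have h2 := preCompMor_nucleus f ((preCompMor f' N).1 g) hx
  have h3 : (preCompMor f' N).1 g = leftComp g f' := rfl
  have h4 := leftComp_nucleus f' f hx
  have h5 := leftComp_of_nucleus hg f' (f.1 x)
  rw [h1, h2, h3, h4, h5]

end RegCompLinear

/-- The covariant functor `Hom_LO(M, -) : LO → LO`, which maps `f` to `g ↦ f ⊚ g`. -/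
noncomputable def homLOFrom (M : LO.{u}) : NonassocFunctor LO.{u} LO.{u} where
  obj X := ⟨⟨leftPara M.mod.carrier X.mod.carrier⟩⟩
  map f := postCompMor M.mod.carrier f
  map_id _ := postCompMor_id
  map_comp f f' := postCompMor_comp f f'

/-- The contravariant functor `Hom_LO(-, M) : LO → RO`, which maps `f` to `g ↦ g ⊚ f`. -/
noncomputable def homLOInto (M : LO.{u}) : NonassocContraFunctor LO.{u} RO.{u} where
  obj X := ⟨⟨leftPara X.mod.carrier M.mod.carrier⟩⟩
  map f := preCompMor f M.mod.carrier
  map_id _ := preCompMor_id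
  map_comp f f' := preCompMor_comp f f'

/-! ### The Hom functors on `𝕆-Mod_ℝ` -/

section RealHom

variable (X : Type*) [AddCommGroup X] [Module ℝ X] [OctBimodule X]
  (V : Type*) [AddCommGroup V] [Module ℝ V]

/-- The bimodule structure on `Hom_ℝ(X, V)` for a bimodule `X`, by `(pf)(x) = f(xp)` and
`(fp)(x) = f(px)`. -/
noncomputable abbrev homIntoBimodule : OctBimodule (X →ₗ[ℝ] V) where
  lsmul := LinearMap.mk₂ ℝ (fun p f => f ∘ₗ OctBimodule.rsmul p)
    (fun p q f => LinearMap.ext fun x => by simp)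
    (fun c p f => LinearMap.ext fun x => by simp)
    (fun p f g => LinearMap.ext fun x => by simp)
    (fun c p f => LinearMap.ext fun x => by simp)
  rsmul := LinearMap.mk₂ ℝ (fun p f => f ∘ₗ OctBimodule.lsmul p)
    (fun p q f => LinearMap.ext fun x => by simp)
    (fun c p f => LinearMap.ext fun x => by simp)
    (fun p f g => LinearMap.ext fun x => by simp)
    (fun c p f => LinearMap.ext fun x => by simp)
  one_lsmul f := LinearMap.ext fun x => by simp [OctBimodule.one_rsmul]
  one_rsmul f := LinearMap.ext fun x => by simp [OctBimodule.one_lsmul]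
  left_alt p q f := LinearMap.ext fun x => by
    have h1 := OctBimodule.assoc_right p q x
    have h2 := OctBimodule.assoc_right q p x
    have h3 := OctBimodule.left_alt p q x
    rw [h1, h2] at h3
    have := congrArg f h3
    simp only [map_sub, map_neg] at this
    simp only [LinearMap.mk₂_apply, LinearMap.sub_apply, LinearMap.neg_apply, LinearMap.comp_apply]
    rw [← neg_sub, this, neg_neg, neg_sub]
  assoc_right p q f := LinearMap.ext fun x => by
    have := congrArg f (OctBimodule.assoc_right p q x)
    simp only [map_sub] at this
    simp only [LinearMap.mk₂_apply, LinearMap.sub_apply, LinearMap.comp_apply]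
    rw [← neg_inj, neg_sub, ← this, neg_sub]
  assoc_middle p q f := LinearMap.ext fun x => by
    have := congrArg f ((OctBimodule.assoc_right p q x).symm.trans
      ((OctBimodule.left_alt p q x).trans (congrArg Neg.neg (OctBimodule.assoc_middle q p x))))
    simp only [map_sub, map_neg] at this
    simp only [LinearMap.mk₂_apply, LinearMap.sub_apply, LinearMap.comp_apply]
    rw [← neg_inj, neg_sub, this, neg_sub]

/-- The bimodule structure on `Hom_ℝ(V, X)` for a bimodule `X`, by `(pf)(v) = p f(v)` and
`(fp)(v) = f(v) p`. -/
noncomputable abbrev homFromBimodule : OctBimodule (V →ₗ[ℝ] X) where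
  lsmul := LinearMap.mk₂ ℝ (fun p f => OctBimodule.lsmul p ∘ₗ f)
    (fun p q f => LinearMap.ext fun x => by simp)
    (fun c p f => LinearMap.ext fun x => by simp)
    (fun p f g => LinearMap.ext fun x => by simp)
    (fun c p f => LinearMap.ext fun x => by simp)
  rsmul := LinearMap.mk₂ ℝ (fun p f => OctBimodule.rsmul p ∘ₗ f)
    (fun p q f => LinearMap.ext fun x => by simp)
    (fun c p f => LinearMap.ext fun x => by simp)
    (fun p f g => LinearMap.ext fun x => by simp)
    (fun c p f => LinearMap.ext fun x => by simp)
  one_lsmul f := LinearMap.ext fun x => OctBimodule.one_lsmul (f x)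
  one_rsmul f := LinearMap.ext fun x => OctBimodule.one_rsmul (f x)
  left_alt p q f := LinearMap.ext fun x => OctBimodule.left_alt p q (f x)
  assoc_right p q f := LinearMap.ext fun x => OctBimodule.assoc_right p q (f x)
  assoc_middle p q f := LinearMap.ext fun x => OctBimodule.assoc_middle p q (f x)

end RealHom

/-- The contravariant functor `Hom_ℝ(-, Re M) : 𝕆-Mod_ℝ → 𝕆-Mod_ℝ`, which maps `f` to `g ↦ g ∘ f`. -/
noncomputable def homRInto (M : LO.{u}) : OModR.{u}ᵒᵖ ⥤ OModR.{u} where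
  obj X := ⟨{ carrier := X.unop.mod.carrier →ₗ[ℝ] nucleus M.mod.carrier
              bimodule := homIntoBimodule _ _ }⟩
  map f := LinearMap.lcomp ℝ (nucleus M.mod.carrier) f.unop
  map_id _ := rfl
  map_comp _ _ := rfl

/-- The covariant functor `Hom_ℝ(Re M, -) : 𝕆-Mod_ℝ → 𝕆-Mod_ℝ`, which maps `f` to `g ↦ f ∘ g`. -/
noncomputable def homRFrom (M : LO.{u}) : OModR.{u} ⥤ OModR.{u} where
  obj X := ⟨{ carrier := nucleus M.mod.carrier →ₗ[ℝ] X.mod.carrier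
              bimodule := homFromBimodule _ _ }⟩
  map f := LinearMap.compRight ℝ f
  map_id _ := rfl
  map_comp _ _ := rfl

/-! ### Para-linear lift and para-linear extension -/

section LiftExt

variable {M M' : Type*} [AddCommGroup M] [Module ℝ M] [OctBimodule M]
  [AddCommGroup M'] [Module ℝ M'] [OctBimodule M']

/-- The map `x ↦ g(x) - ∑ᵢ eᵢ g(eᵢ x)`, with `i = 1, …, 7`. -/
noncomputable def liftMap (g : M →ₗ[ℝ] nucleus M') : M →ₗ[ℝ] M' :=
  (nucleus M').subtype ∘ₗ g - ∑ i : Fin 7,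
    OctBimodule.lsmul (e i.succ) ∘ₗ (nucleus M').subtype ∘ₗ g ∘ₗ OctBimodule.lsmul (e i.succ)

theorem liftMap_apply (g : M →ₗ[ℝ] nucleus M') (x : M) :
    liftMap g x = g x - ∑ i : Fin 7, e i.succ •ₗ (g (e i.succ •ₗ x) : M') := by
  simp [liftMap]

theorem reOp_lsmul_liftMap (g : M →ₗ[ℝ] nucleus M') (p : Octonion) (x : M) :
    reOp (p •ₗ liftMap g x) = (g (p •ₗ x) : M') := by
  have hc : ∀ i : Fin 7, coord 0 (p * e i.succ) = -coord i.succ p := fun i => by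
    fin_cases i <;> simp [coord_mul, mulCoord, coord_e]
  rw [liftMap_apply]
  simp only [map_sub, map_sum, nucleus_mul (g _).2, reOp_lsmul (g _).2, hc]
  conv_rhs => rw [eq_sum p, Fin.sum_univ_succ]
  simp [e_zero_lsmul]

theorem liftMap_mem (g : M →ₗ[ℝ] nucleus M') : liftMap g ∈ leftPara M M' := fun p x => by
  have h := reOp_lsmul_liftMap g 1 (p •ₗ x)
  simp only [OctBimodule.one_lsmul] at h
  rw [assocA_apply, map_sub, reOp_lsmul_liftMap, h, sub_self]

theorem liftMap_add (g h : M →ₗ[ℝ] nucleus M') : liftMap (g + h) = liftMap g + liftMap h :=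
  LinearMap.ext fun x => by
    simp only [liftMap_apply, LinearMap.add_apply, Submodule.coe_add, map_add,
      Finset.sum_add_distrib]
    abel

theorem liftMap_smul (r : ℝ) (g : M →ₗ[ℝ] nucleus M') : liftMap (r • g) = r • liftMap g :=
  LinearMap.ext fun x => by
    simp only [liftMap_apply, LinearMap.smul_apply, Submodule.coe_smul, map_smul, smul_sub,
      Finset.smul_sum]

/-- The para-linear lift `l-lif : Hom_ℝ(M, Re M') → Hom_LO(M, M')`, with
`(l-lif g)(x) = g(x) - ∑ᵢ eᵢ g(eᵢ x)`. -/
noncomputable def lLift (M M' : Type*) [AddCommGroup M] [Module ℝ M] [OctBimodule M]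
    [AddCommGroup M'] [Module ℝ M'] [OctBimodule M'] :
    (M →ₗ[ℝ] nucleus M') →ₗ[ℝ] leftPara M M' where
  toFun g := ⟨liftMap g, liftMap_mem g⟩
  map_add' g h := Subtype.ext (liftMap_add g h)
  map_smul' r g := Subtype.ext (liftMap_smul r g)

/-- The real part as a map `M → Re M`. -/
noncomputable def rePart : M →ₗ[ℝ] nucleus M := LinearMap.codRestrict _ reOp reOp_mem

/-- The map `x ↦ ∑ᵢ eᵢ g(xᵢ)`, where `x = ∑ᵢ eᵢ xᵢ` with `xᵢ = Re (ēᵢ x)` and `i = 0, …, 7`. -/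
noncomputable def extMap (g : nucleus M →ₗ[ℝ] M') : M →ₗ[ℝ] M' :=
  ∑ i : Fin 8, OctBimodule.lsmul (e i) ∘ₗ g ∘ₗ rePart ∘ₗ OctBimodule.lsmul (conj (e i))

theorem extMap_apply (g : nucleus M →ₗ[ℝ] M') (x : M) :
    extMap g x = ∑ i : Fin 8, e i •ₗ g (rePart (conj (e i) •ₗ x)) := by
  simp [extMap]

/-- `(l-ext g)(px) = p g(x)` for all `x` in `Re M`. -/
theorem extMap_lsmul (g : nucleus M →ₗ[ℝ] M') (p : Octonion) (x : nucleus M) :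
    extMap g (p •ₗ (x : M)) = p •ₗ g x := by
  have hc : ∀ i : Fin 8, coord 0 (conj (e i) * p) = coord i p := fun i => by
    refine Fin.cases ?_ (fun j => ?_) i
    · rw [conj_e_zero, ← one_eq, one_mul]
    · rw [conj_e_succ]
      fin_cases j <;> simp [coord_mul, mulCoord, coord_e]
  have h : ∀ i : Fin 8, rePart (conj (e i) •ₗ (p •ₗ (x : M))) = coord i p • x := fun i =>
    Subtype.ext (by
      change reOp _ = coord i p • (x : M)
      rw [nucleus_mul x.2, reOp_lsmul x.2, hc])
  rw [extMap_apply]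
  simp only [h, map_smul]
  conv_rhs => rw [eq_sum p]
  simp

theorem extMap_nucleus (g : nucleus M →ₗ[ℝ] M') (x : nucleus M) : extMap g (x : M) = g x := by
  simpa [OctBimodule.one_lsmul] using extMap_lsmul g 1 x

theorem extMap_mem (g : nucleus M →ₗ[ℝ] M') : extMap g ∈ leftPara M M' :=
  mem_leftPara fun p x hx => by
    rw [extMap_lsmul g p ⟨x, hx⟩, extMap_nucleus g ⟨x, hx⟩]

/-- The para-linear extension `l-ext : Hom_ℝ(Re M, M') → Hom_LO(M, M')`, with
`(l-ext g)(px) = p g(x)` for `x` in `Re M`. -/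
noncomputable def lExt (M M' : Type*) [AddCommGroup M] [Module ℝ M] [OctBimodule M]
    [AddCommGroup M'] [Module ℝ M'] [OctBimodule M'] :
    (nucleus M →ₗ[ℝ] M') →ₗ[ℝ] leftPara M M' where
  toFun g := ⟨extMap g, extMap_mem g⟩
  map_add' g h := Subtype.ext (LinearMap.ext fun x => by
    simp [extMap_apply, Finset.sum_add_distrib])
  map_smul' r g := Subtype.ext (LinearMap.ext fun x => by
    simp [extMap_apply, Finset.smul_sum])

/-- The restriction `Hom_LO(M, M') → Hom_ℝ(Re M, M')`. -/
noncomputable def restrictRe (M M' : Type*) [AddCommGroup M] [Module ℝ M] [OctBimodule M]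
    [AddCommGroup M'] [Module ℝ M'] [OctBimodule M'] :
    leftPara M M' →ₗ[ℝ] (nucleus M →ₗ[ℝ] M') :=
  LinearMap.lcomp ℝ M' (nucleus M).subtype ∘ₗ (leftPara M M').subtype

end LiftExt

/-- The family `l-lif_X : Hom_ℝ(X, Re M) → Hom_LO(X, M)` of morphisms of `𝕆-Mod_ℝ`. -/
noncomputable def lLiftMor (M X : LO.{u}) :
    (homRInto M).obj (op (ιLO.obj X)) ⟶ ιRO.obj ((homLOInto M).obj X) :=
  lLift X.mod.carrier M.mod.carrier

/-- The family `l-ext_X : Hom_ℝ(Re M, X) → Hom_LO(M, X)` of morphisms of `𝕆-Mod_ℝ`. -/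
noncomputable def lExtMor (M X : LO.{u}) :
    (homRFrom M).obj (ιLO.obj X) ⟶ ιLO.obj ((homLOFrom M).obj X) :=
  lExt M.mod.carrier X.mod.carrier

/-- The family of restrictions `Hom_LO(M, X) → Hom_ℝ(Re M, X)` of morphisms of `𝕆-Mod_ℝ`. -/
noncomputable def restrictReMor (M X : LO.{u}) :
    ιLO.obj ((homLOFrom M).obj X) ⟶ (homRFrom M).obj (ιLO.obj X) :=
  restrictRe M.mod.carrier X.mod.carrier

end ParaLinear

open ParaLinear CategoryTheory

namespace ParaLinear

open Octonion Opposite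

universe u

/-! ### Real parts of values, and the inverse of the lift. -/

section LiftExt

variable {M M' M'' : Type*} [AddCommGroup M] [Module ℝ M] [OctBimodule M]
  [AddCommGroup M'] [Module ℝ M'] [OctBimodule M']
  [AddCommGroup M''] [Module ℝ M''] [OctBimodule M'']

/-! A left para-linear map `f : M → M'` can be recovered from either of two smaller pieces of data,
and each part of the theorem rests on one of them.

The first is the real part of its values. Para-linearity says `Re f(px) = Re (p f(x))`. The
coordinates of `f(x)` in `M' = ⨁ eᵢ Re M'` are `Re (ēᵢ f(x))`, hence equal to `Re f(ēᵢ x)`. With `g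
= Re ∘ f` this gives `f(x) = ∑ eᵢ g(ēᵢ x) = g(x) - ∑ eᵢ g(eᵢ x)`, the last sum being over `i ≥ 1`,
which is the formula of the lift. Conversely any real linear `g` with values in `Re M'` has a
para-linear lift with real part `g` (`reOp_lLift`). So the lift and `f ↦ Re ∘ f` are mutually
inverse.

The second is the restriction to `Re M`. Since `f(px) = p f(x)` for `x` in `Re M`, and `M` is the
sum of the `eᵢ Re M`, the map `f` is determined by `f|_{Re M}`. That restriction may be any real
linear map, so the extension and the restriction are mutually inverse.

Naturality holds because the regular composition has the same data of both kinds as the plain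
composition `f ∘ g`. Its correction terms lie in `eⱼ Re` with `j ≥ 1`, so they vanish under `Re`
(`reOp_regComp`). They also vanish on `Re M`, where the second associator of a para-linear map is
zero (`restrictRe_leftComp`). Thus the regular composition of para-linear maps, although in general
different from `f ∘ g`, is the para-linear map with the real part of `f ∘ g`, and also the one with
its restriction to `Re M`. Both naturality squares follow by comparing these data: precomposition by
real parts in `leftComp_lLift`, postcomposition by restrictions in `leftComp_lExt`.

The bimodule structures on the Hom spaces play no role in these comparisons. They make the Hom
spaces objects of the categories, while a morphism of `𝕆-Mod_ℝ` only has to be real linear. -/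

theorem rePart_coe (x : M) : (rePart x : M) = reOp x := rfl

/-- A left para-linear map is determined by its real part. -/
theorem left_ext_reOp {f g : leftPara M M'} (h : ∀ x, reOp (f.1 x) = reOp (g.1 x)) : f = g := by
  -- An element of a bimodule vanishes once `Re (p y) = 0` for every octonion `p`, because its
  -- coordinates are the values at `p = ēᵢ`. This is used with `y = f(x) - g(x)`.
  refine Subtype.ext (LinearMap.ext fun x => sub_eq_zero.mp (eq_zero_of_reOp_lsmul fun p => ?_))
  -- Para-linearity moves `p` into the argument, so the hypothesis is needed at `px` and not only at
  -- `x`.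
  rw [map_sub, map_sub, ← re_left f.2, ← re_left g.2, h, sub_self]

/-- Each correction term is `eⱼ` times a real element with `j ≥ 1`, and the projection onto the
summand with index `0` kills it. Neither map has to be para-linear. -/
theorem reOp_regComp (g : M' →ₗ[ℝ] M'') (f : M →ₗ[ℝ] M') (x : M) :
    reOp (regComp g f x) = reOp (g (f x)) := by
  rw [regComp_apply, map_sub, map_sum, sub_eq_self]
  refine Finset.sum_eq_zero fun j _ => ?_
  rw [reOp_e_lsmul (reOp_mem _), if_neg j.succ_ne_zero]

/-- In the defining sum of the lift only the first term lies in `Re M'`; the others lie in the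
summands `eᵢ Re M'` with `i ≥ 1`. Together with `left_ext_reOp` this characterises the lift, so that
later arguments never return to its formula. -/
theorem reOp_lLift (g : M →ₗ[ℝ] nucleus M') (x : M) :
    reOp ((lLift M M' g).1 x) = (g x : M') := by
  -- `reOp_lsmul_liftMap` computes all coordinates, `Re (p · lift) = g(px)`; the real part is the
  -- case `p = 1`.
  have h := reOp_lsmul_liftMap g 1 x
  rwa [OctBimodule.one_lsmul, OctBimodule.one_lsmul] at h

/-- This is the naturality square of the lift, evaluated at `g`. Both sides are para-linear, so it
suffices that both have real part `g ∘ f`: on the left the correction of the regular composition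
disappears under `Re`, and the lift then returns `g` at `f(x)`. No associativity of `f` is needed.
-/
theorem leftComp_lLift (g : M' →ₗ[ℝ] nucleus M'') (f : leftPara M M') :
    leftComp (lLift M' M'' g) f = lLift M M'' (g ∘ₗ f.1) :=
  left_ext_reOp fun x => by
    rw [leftComp_val, reOp_regComp, reOp_lLift, reOp_lLift, LinearMap.comp_apply]

/-- Taking real parts of values, `f ↦ Re ∘ f`, as a map `Hom_LO(M, M') → Hom_ℝ(M, Re M')`. -/
noncomputable def rePartComp (M M' : Type*) [AddCommGroup M] [Module ℝ M] [OctBimodule M]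
    [AddCommGroup M'] [Module ℝ M'] [OctBimodule M'] :
    leftPara M M' →ₗ[ℝ] (M →ₗ[ℝ] nucleus M') :=
  LinearMap.compRight ℝ rePart ∘ₗ (leftPara M M').subtype

theorem rePartComp_apply (f : leftPara M M') (x : M) : rePartComp M M' f x = rePart (f.1 x) := rfl

theorem rePartComp_lLift (g : M →ₗ[ℝ] nucleus M') : rePartComp M M' (lLift M M' g) = g :=
  LinearMap.ext fun x => Subtype.ext (reOp_lLift g x)

/-- This is surjectivity of the lift. Here the para-linearity of `f` is essential: the lift of `Re ∘
f` remembers only the real part of `f`, and `left_ext_reOp` says that nothing has been lost. -/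
theorem lLift_rePartComp (f : leftPara M M') : lLift M M' (rePartComp M M' f) = f :=
  left_ext_reOp fun x => by rw [reOp_lLift, rePartComp_apply, rePart_coe]

/-! ### Extension from the real part, and restriction to it. -/

theorem lExt_nucleus (g : nucleus M →ₗ[ℝ] M') {x : M} (hx : x ∈ nucleus M) :
    (lExt M M' g).1 x = g ⟨x, hx⟩ := extMap_nucleus g ⟨x, hx⟩

theorem restrictRe_lExt (g : nucleus M →ₗ[ℝ] M') : restrictRe M M' (lExt M M' g) = g :=
  LinearMap.ext fun x => extMap_nucleus g x

/-- Para-linear maps that agree on `Re M` are equal, since they commute with left multiplication on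
elements of `Re M` and the `eᵢ Re M` span `M`. On `Re M` the extension returns the values it was
built from. -/
theorem lExt_restrictRe (f : leftPara M M') : lExt M M' (restrictRe M M' f) = f :=
  left_ext fun _ hx => lExt_nucleus _ hx

/-- For `x` in `Re M` the para-linear map `g` satisfies `g(eⱼ x) = eⱼ g(x)`, so every `A_{eⱼ}(x, g)`
vanishes and no correction remains. The element `g(x)` need not be real, so the whole of `f` stays
on the right and not its restriction. This is the naturality square of the restriction. -/
theorem restrictRe_leftComp (f : leftPara M' M'') (g : leftPara M M') :
    restrictRe M M'' (leftComp f g) = f.1 ∘ₗ restrictRe M M' g :=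
  LinearMap.ext fun x => leftComp_nucleus f g x.2

/-- Naturality passes from a family of bijections to the family of inverses: the square for the
restriction, conjugated by the inverse pair, is the square for the extension. -/
theorem leftComp_lExt (f : leftPara M' M'') (g : nucleus M →ₗ[ℝ] M') :
    leftComp f (lExt M M' g) = lExt M M'' (f.1 ∘ₗ g) := by
  -- The left side is para-linear, hence the extension of its own restriction; that restriction is
  -- `f ∘ g`.
  rw [← lExt_restrictRe (leftComp f _), restrictRe_leftComp, restrictRe_lExt]

end LiftExt

/-! ### The components as isomorphisms of `𝕆-Mod_ℝ`, and their naturality. -/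

/-- The family `f ↦ Re ∘ f : Hom_LO(X, M) → Hom_ℝ(X, Re M)` of morphisms of `𝕆-Mod_ℝ`. -/
noncomputable def rePartCompMor (M X : LO.{u}) :
    ιRO.obj ((homLOInto M).obj X) ⟶ (homRInto M).obj (op (ιLO.obj X)) :=
  rePartComp X.mod.carrier M.mod.carrier

/-- Composition in `𝕆-Mod_ℝ` is that of maps, written in diagrammatic order, so this and the next
three identities are the pointwise inverse relations proved above. -/
theorem lLiftMor_rePartCompMor (M X : LO.{u}) :
    lLiftMor M X ≫ rePartCompMor M X = 𝟙 ((homRInto M).obj (op (ιLO.obj X))) :=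
  LinearMap.ext rePartComp_lLift

theorem rePartCompMor_lLiftMor (M X : LO.{u}) :
    rePartCompMor M X ≫ lLiftMor M X = 𝟙 (ιRO.obj ((homLOInto M).obj X)) :=
  LinearMap.ext lLift_rePartComp

theorem lExtMor_restrictReMor (M X : LO.{u}) :
    lExtMor M X ≫ restrictReMor M X = 𝟙 ((homRFrom M).obj (ιLO.obj X)) :=
  LinearMap.ext restrictRe_lExt

theorem restrictReMor_lExtMor (M X : LO.{u}) :
    restrictReMor M X ≫ lExtMor M X = 𝟙 (ιLO.obj ((homLOFrom M).obj X)) :=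
  LinearMap.ext lExt_restrictRe

/-- The weak functors leave maps unchanged, so the square at `f`, evaluated at `g`, unfolds to the
identity of `leftComp_lLift`. The arrow `g ↦ g ⊚ f` is a morphism of `RO`, but only its underlying
real linear map enters. -/
theorem isContraNatLiftIso_lLiftMor (M : LO.{u}) :
    IsContraNatLiftIso ιLO ιRO (homRInto M) (homLOInto M) (lLiftMor M) :=
  ⟨fun _ _ f => LinearMap.ext fun g => leftComp_lLift g f,
    fun X => ⟨rePartCompMor M X, lLiftMor_rePartCompMor M X, rePartCompMor_lLiftMor M X⟩⟩

/-- The extension goes from the real Hom functor to the para-linear one, so in terms of direction it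
is a lift transformation; the extension transformation is its inverse, the restriction. -/
theorem isNatLiftIso_lExtMor (M : LO.{u}) :
    IsNatLiftIso ιLO ιLO (homRFrom M) (homLOFrom M) (lExtMor M) :=
  ⟨fun _ _ f => LinearMap.ext fun g => leftComp_lExt f g,
    fun X => ⟨restrictReMor M X, lExtMor_restrictReMor M X, restrictReMor_lExtMor M X⟩⟩

theorem isNatExtIso_restrictReMor (M : LO.{u}) :
    IsNatExtIso ιLO ιLO (homRFrom M) (homLOFrom M) (restrictReMor M) :=
  ⟨fun _ _ f => LinearMap.ext fun g => (restrictRe_leftComp f g).symm,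
    fun X => ⟨lExtMor M X, restrictReMor_lExtMor M X, lExtMor_restrictReMor M X⟩⟩

end ParaLinear

/-- For every `𝕆`-bimodule `M`: the para-linear lift is a natural lift isomorphism
`Hom_ℝ(-, Re M) ≅ Hom_LO(-, M)` of contravariant functors; the para-linear extension is a natural
isomorphism `Hom_ℝ(Re M, -) ≅ Hom_LO(M, -)`, with inverse the restriction to `Re M`, which is a natural
extension isomorphism; so `Hom_ℝ(-, Re M)` and `Hom_ℝ(Re M, -)` are natural associated functors of
`Hom_LO(-, M)` and `Hom_LO(M, -)`. -/
theorem mainTheorem9 (M : LO) :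
    IsContraNatLiftIso ιLO ιRO (homRInto M) (homLOInto M) (lLiftMor M) ∧
    IsNatLiftIso ιLO ιLO (homRFrom M) (homLOFrom M) (lExtMor M) ∧
    IsNatExtIso ιLO ιLO (homRFrom M) (homLOFrom M) (restrictReMor M) ∧
    (∀ X : LO, lExtMor M X ≫ restrictReMor M X = 𝟙 ((homRFrom M).obj (ιLO.obj X)) ∧
      restrictReMor M X ≫ lExtMor M X = 𝟙 (ιLO.obj ((homLOFrom M).obj X))) ∧
    IsContraNatAssociated ιLO ιRO (homRInto M) (homLOInto M) ∧
    IsNatAssociated ιLO ιLO (homRFrom M) (homLOFrom M) :=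
  ⟨isContraNatLiftIso_lLiftMor M, isNatLiftIso_lExtMor M, isNatExtIso_restrictReMor M,
    fun X => ⟨lExtMor_restrictReMor M X, restrictReMor_lExtMor M X⟩,
    -- An associated functor may be witnessed by an isomorphism in either direction: the lift serves
    -- for `Hom_ℝ(-, Re M)`, and the restriction, as an extension isomorphism, for `Hom_ℝ(Re M, -)`.
    Or.inl ⟨_, isContraNatLiftIso_lLiftMor M⟩, Or.inr ⟨_, isNatExtIso_restrictReMor M⟩⟩
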